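/- **Theorem.** Let $N\ge 3$ and consider the Hilbert space $(\mathbb{C}^2)^{\otimes N}$ of $N$ spins $1/2$ on the periodic chain with sites $j\in\mathbb{Z}/N\mathbb{Z}$. Let $\sigma_j^x,\sigma_j^y,\sigma_j^z$ be the Pauli matrices acting on site $j$, also written $X_j,Y_j,Z_j$, and let $I_j$ be the identity on site $j$. For real parameters put $$H_2=\sum_{j=1}^{N}\bigl(J^{xy}\sigma_j^x\sigma_{j+1}^y+J^{yz}\sigma_j^y\sigma_{j+1}^z\bigr),\qquad H_3=\sum_{j=1}^{N}\bigl(J^{xx}\sigma_j^x\sigma_{j+1}^x+J^{yz}\sigma_j^y\sigma_{j+1}^z\bigr).$$ For an integer $k\ge 0$, a *$k$-local conserved quantity* of a Hamiltonian $H$ is an operator $Q$ with $[Q,H]=0$ of the form $$Q=\sum_{\ell=1}^{k}\ \sum_{A^1,\dots,A^\ell}\ \sum_{j=1}^{N} q^{(\ell)}_{A^1\cdots A^\ell,\,j}\;A^1_jA^2_{j+1}\cdots A^\ell_{j+\ell-1}\;+\;q^{(0)}\,\mathbb{1},$$ with real coefficients $q^{(\ell)}_{A^1\cdots A^\ell,\,j}$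 and $q^{(0)}$, where the middle sum runs over all sequences of symbols $A^1,\dots,A^\ell\in\{X,Y,Z,I\}$ with $A^1\ne I$ and $A^\ell\neq I$. Let $k\le N/2$. 1. If $J^{xy}\neq0$ and $J^{yz}\ne0$, then every $k$-local conserved quantity $Q$ of $H_2$ is of the form $Q=aH_2+b\,\mathbb{1}$ with $a,b\in\mathbb{R}$. 2. If $J^{xx}\neq0$ and $J^{yz}\ne0$, then every $k$-local conserved quantity $Q$ of $H_3$ is of the form $Q=aH_3+b\,\mathbb{1}$ with $a,b\in\mathbb{R}$. -/

import Mathlib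

open Matrix

noncomputable section

namespace SpinChain

/-- The symbols `I, X, Y, Z` that label the one-site operators. -/
inductive PauliSymbol
  | I | X | Y | Z
  deriving DecidableEq

instance : Fintype PauliSymbol where
  elems := {.I, .X, .Y, .Z}
  complete A := by cases A <;> decide

/-- The `2 × 2` matrix of a symbol, in the eigenbasis `|0⟩, |1⟩` of `σ^z`. -/
def PauliSymbol.toMatrix : PauliSymbol → Matrix (Fin 2) (Fin 2) ℂ
  | .I => 1
  | .X => !![0, 1; 1, 0]
  | .Y => !![0, -Complex.I; Complex.I, 0]
  | .Z => !![1, 0; 0, -1]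

/-- Operators on the `2 ^ N`-dimensional Hilbert space of `N` spins `1/2`, as matrices in the
computational basis, whose vectors are labelled by the configurations `ZMod N → Fin 2`. The sites
are the elements of `ZMod N`, so that the chain is periodic. -/
abbrev Operator (N : ℕ) : Type := Matrix (ZMod N → Fin 2) (ZMod N → Fin 2) ℂ

/-- The tensor product over all sites `s` of the one-site operators `M s`. -/
def tensorOp {N : ℕ} [NeZero N] (M : ZMod N → Matrix (Fin 2) (Fin 2) ℂ) : Operator N :=
  Matrix.of fun σ τ => ∏ s, M s (σ s) (τ s)

/-- The operator that acts as the symbol `A` on the site `j` and as the identity elsewhere. -/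
def siteOp {N : ℕ} [NeZero N] (A : PauliSymbol) (j : ZMod N) : Operator N :=
  tensorOp (Function.update (fun _ => 1) j A.toMatrix)

/-- `∑ j, (Jxy σ^x_j σ^y_{j+1} + Jyz σ^y_j σ^z_{j+1})`. -/
def hamiltonian2 (N : ℕ) [NeZero N] (Jxy Jyz : ℝ) : Operator N :=
  ∑ j : ZMod N, ((Jxy : ℂ) • (siteOp .X j * siteOp .Y (j + 1))
    + (Jyz : ℂ) • (siteOp .Y j * siteOp .Z (j + 1)))

/-- `∑ j, (Jxx σ^x_j σ^x_{j+1} + Jyz σ^y_j σ^z_{j+1})`. -/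
def hamiltonian3 (N : ℕ) [NeZero N] (Jxx Jyz : ℝ) : Operator N :=
  ∑ j : ZMod N, ((Jxx : ℂ) • (siteOp .X j * siteOp .X (j + 1))
    + (Jyz : ℂ) • (siteOp .Y j * siteOp .Z (j + 1)))

/-- The sequences `A¹, …, A^ℓ` of symbols whose first and last members are not `I`. -/
def sequences (ℓ : ℕ) : Finset (Fin ℓ → PauliSymbol) :=
  {A | ∀ i : Fin ℓ, (i.val = 0 ∨ i.val + 1 = ℓ) → A i ≠ .I}

/-- The product `A¹_j A²_{j+1} ⋯ A^ℓ_{j+ℓ-1}`. -/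
def stringOp {N : ℕ} [NeZero N] {ℓ : ℕ} (A : Fin ℓ → PauliSymbol) (j : ZMod N) : Operator N :=
  (List.ofFn fun i : Fin ℓ => siteOp (A i) (j + (i.val : ZMod N))).prod

/-- Real linear combinations of the identity and of the strings of length at most `k`. -/
def IsLocal {N : ℕ} [NeZero N] (k : ℕ) (Q : Operator N) : Prop :=
  ∃ (q : (ℓ : ℕ) → (Fin ℓ → PauliSymbol) → ZMod N → ℝ) (q₀ : ℝ),
    Q = (∑ ℓ ∈ Finset.Icc 1 k, ∑ A ∈ sequences ℓ, ∑ j : ZMod N, (q ℓ A j : ℂ) • stringOp A j)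
      + (q₀ : ℂ) • (1 : Operator N)

/-- `Q` is a `k`-local conserved quantity of the Hamiltonian `H`. -/
def IsLocalConserved {N : ℕ} [NeZero N] (k : ℕ) (H Q : Operator N) : Prop :=
  IsLocal k Q ∧ ⁅Q, H⁆ = 0

end SpinChain

end

/-! Expand `Q` in products of Pauli symbols. These are linearly independent, and the commutator of
two of them is zero or ±2i times a third one, so `[Q, H] = 0` amounts to one real linear equation
for each product (`IsStationary`). The permutation X → Y → Z → X turns XY + ZZ into YZ + XX, so both
Hamiltonians are covered by J₁ XY + J₂ wZ with w = Y or w = Z.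

Let `Q` be supported in arcs of k sites. Since 2k ≤ N, a string of length k + 1 in the commutator
arises only by attaching a bond to the left or the right end of a string of length k
(`IsStationary.top`). The two bonds differ in their first symbols and in their second symbols, so
such an equation links at most two coefficients: that of a string f, and that of its shift, which
gains a bond on the right and loses its first symbol on the left. Under repeated shifts a
coefficient is either found to vanish or is reduced to that of X Z⋯Z Y. This string is its own
shift, so its coefficient q does not depend on the site, and if q = 0 then all strings of length k
vanish (`IsLocalStationary.eq_zero_of_mainString`).

For k ≥ 3 the equations of strings of length k give q = 0. Strings with an interior identity have
coefficient zero. Hence in the equation of a suitable string with one interior identity only a few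
terms survive: the strings of length k - 1 that lack the first or the last symbol, and a multiple of
q from the bond that fills the identity (`IsLocalStationary.chain_step`). Let the identity move from
the second to the last but one position. The terms of length k - 1 telescope, and the multiples of q
add up with equal signs to (k - 1) q times a nonzero constant, which must vanish.

So the support shrinks down to k = 2, where q is the coefficient of a single XY bond; subtracting
multiples of H and of the identity makes it zero in advance (`exists_eq_of_vanishing`). One-site
terms are excluded by the equations of strings of length two (`IsStationary.single_eq_zero`). -/

namespace SpinChain

/-! ### Multiplication of Pauli symbols up to phase. -/

namespace PauliSymbol

/-- The product of two symbols up to a phase. -/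
def mul : PauliSymbol → PauliSymbol → PauliSymbol
  | .I, B => B
  | A, .I => A
  | .X, .X => .I
  | .X, .Y => .Z
  | .X, .Z => .Y
  | .Y, .X => .Z
  | .Y, .Y => .I
  | .Y, .Z => .X
  | .Z, .X => .Y
  | .Z, .Y => .X
  | .Z, .Z => .I

instance : Mul PauliSymbol := ⟨mul⟩

/-- `1` if the symbols commute and `0` otherwise. -/
def commuteSign : PauliSymbol → PauliSymbol → ℤ
  | .I, _ => 1
  | _, .I => 1
  | .X, .X => 1
  | .Y, .Y => 1
  | .Z, .Z => 1
  | _, _ => 0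

/-- The Levi-Civita sign: `A B = ± i (A * B)` for anticommuting symbols, `0` for commuting ones. -/
def sgn : PauliSymbol → PauliSymbol → ℤ
  | .X, .Y => 1
  | .Y, .Z => 1
  | .Z, .X => 1
  | .Y, .X => -1
  | .Z, .Y => -1
  | .X, .Z => -1
  | _, _ => 0

/-- The phase in the product of two symbols. -/
noncomputable def phase (A B : PauliSymbol) : ℂ := commuteSign A B + sgn A B * Complex.I

theorem commuteSign_comm (A B : PauliSymbol) : commuteSign A B = commuteSign B A := by
  cases A <;> cases B <;> rfl

theorem sgn_antisymm (A B : PauliSymbol) : sgn A B = -sgn B A := by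
  cases A <;> cases B <;> rfl

theorem mul_comm' (A B : PauliSymbol) : A * B = B * A := by
  cases A <;> cases B <;> rfl

theorem mul_I (A : PauliSymbol) : A * I = A := by cases A <;> rfl

theorem I_mul (A : PauliSymbol) : I * A = A := by cases A <;> rfl

theorem mul_mul_self (A B : PauliSymbol) : A * B * B = A := by
  cases A <;> cases B <;> rfl

theorem mul_eq_I_iff (A B : PauliSymbol) : A * B = I ↔ A = B := by
  revert A B; decide

theorem I_phase (A : PauliSymbol) : phase I A = 1 := by
  cases A <;> simp [phase, commuteSign, sgn]

theorem phase_self (A : PauliSymbol) : phase A A = 1 := by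
  cases A <;> simp [phase, commuteSign, sgn]

theorem phase_I (A : PauliSymbol) : phase A I = 1 := by
  cases A <;> simp [phase, commuteSign, sgn]

theorem toMatrix_mul (A B : PauliSymbol) :
    A.toMatrix * B.toMatrix = phase A B • (A * B).toMatrix := by
  cases A <;> cases B <;>
    · change _ = _ • PauliSymbol.toMatrix (mul _ _)
      ext i j
      fin_cases i <;> fin_cases j <;> simp [toMatrix, mul, phase, commuteSign, sgn]

theorem trace_toMatrix (A : PauliSymbol) : A.toMatrix.trace = if A = I then 2 else 0 := by
  cases A <;> simp [toMatrix, Matrix.trace]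

/-- The sign in the commutator of `A ⊗ B` with `u ⊗ e`. -/
def weight (A B u e : PauliSymbol) : ℤ := sgn A u * commuteSign B e + commuteSign A u * sgn B e

/-- Exchanging the factors conjugates each phase, so the difference is 2i times the imaginary part
of the product, which is `weight`. -/
theorem phase_commutator (A B u e : PauliSymbol) :
    phase A u * phase B e - phase u A * phase e B = 2 * Complex.I * weight A B u e := by
  rw [phase, phase, phase, phase, weight, commuteSign_comm u A, commuteSign_comm e B, sgn_antisymm u A,
    sgn_antisymm e B]
  push_cast
  ring

/-- The cyclic permutation `X ↦ Z ↦ Y ↦ X`. -/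
def cycle : PauliSymbol → PauliSymbol
  | .I => .I
  | .X => .Z
  | .Y => .X
  | .Z => .Y

/-- The cyclic permutation `X ↦ Y ↦ Z ↦ X`. -/
def uncycle : PauliSymbol → PauliSymbol
  | .I => .I
  | .X => .Y
  | .Y => .Z
  | .Z => .X

theorem uncycle_cycle (A : PauliSymbol) : A.cycle.uncycle = A := by cases A <;> rfl

theorem uncycle_mul (A B : PauliSymbol) : (A * B).uncycle = A.uncycle * B.uncycle := by
  cases A <;> cases B <;> rfl

theorem commuteSign_uncycle (A B : PauliSymbol) : commuteSign A.uncycle B.uncycle = commuteSign A B := by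
  cases A <;> cases B <;> rfl

theorem sgn_uncycle (A B : PauliSymbol) : sgn A.uncycle B.uncycle = sgn A B := by
  cases A <;> cases B <;> rfl

theorem weight_uncycle (A B u e : PauliSymbol) :
    weight A.uncycle B.uncycle u.uncycle e.uncycle = weight A B u e := by
  simp only [weight, commuteSign_uncycle, sgn_uncycle]

end PauliSymbol

open PauliSymbol

/-- A choice of a symbol for every site. -/
abbrev Config (N : ℕ) : Type := ZMod N → PauliSymbol

/-! ### Pauli products as a basis, and the commutator in coordinates. -/

section Operators

variable {N : ℕ}

theorem mul_eq_I_config_iff (P Q : Config N) : (P * Q = fun _ => I) ↔ P = Q := by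
  simp only [funext_iff, Pi.mul_apply, mul_eq_I_iff]

theorem self_ne_add_one (hN : 2 ≤ N) (s : ZMod N) : s ≠ s + 1 := by
  have : Fact (1 < N) := ⟨hN⟩
  intro h
  exact one_ne_zero (left_eq_add.1 h)

variable [NeZero N]

theorem tensorOp_mul (M M' : ZMod N → Matrix (Fin 2) (Fin 2) ℂ) :
    tensorOp M * tensorOp M' = tensorOp (fun s => M s * M' s) := by
  ext σ τ
  simp only [tensorOp, Matrix.mul_apply, Matrix.of_apply, ← Finset.prod_mul_distrib]
  rw [Finset.prod_univ_sum]
  simp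

theorem trace_tensorOp (M : ZMod N → Matrix (Fin 2) (Fin 2) ℂ) :
    (tensorOp M).trace = ∏ s, (M s).trace := by
  simp only [tensorOp, Matrix.trace, Matrix.diag_apply, Matrix.of_apply]
  rw [Finset.prod_univ_sum]
  simp

/-- The product over all sites `s` of the symbol `P s`. -/
noncomputable def pauliOp (P : Config N) : Operator N := tensorOp fun s => (P s).toMatrix

theorem pauliOp_mul (P Q : Config N) :
    pauliOp P * pauliOp Q = (∏ s, phase (P s) (Q s)) • pauliOp (P * Q) := by
  rw [pauliOp, pauliOp, tensorOp_mul]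
  ext σ τ
  simp only [toMatrix_mul, pauliOp, tensorOp, Matrix.of_apply, Matrix.smul_apply, smul_eq_mul,
    Finset.prod_mul_distrib, Pi.mul_apply]

theorem pauliOp_I : pauliOp (fun _ : ZMod N => I) = 1 := by
  ext σ τ
  simp only [pauliOp, tensorOp, toMatrix, Matrix.of_apply, Matrix.one_apply]
  rw [Finset.prod_ite_zero]
  simp [funext_iff]

theorem trace_pauliOp (P : Config N) :
    (pauliOp P).trace = if P = fun _ => I then 2 ^ N else 0 := by
  rw [pauliOp, trace_tensorOp]
  simp only [trace_toMatrix]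
  rw [Finset.prod_ite_zero]
  simp [funext_iff, ZMod.card]

theorem siteOp_eq_pauliOp (A : PauliSymbol) (j : ZMod N) :
    siteOp A j = pauliOp (Function.update (fun _ => I) j A) := by
  rw [siteOp, pauliOp]
  congr 1
  funext s
  by_cases h : s = j
  · subst h; simp
  · simp [h, toMatrix]

theorem pauliOp_mul_siteOp (P : Config N) (A : PauliSymbol) (s : ZMod N) (h : P s = I) :
    pauliOp P * siteOp A s = pauliOp (Function.update P s A) := by
  rw [siteOp_eq_pauliOp, pauliOp_mul]
  have h1 : ∏ t, phase (P t) (Function.update (fun _ => I) s A t) = 1 := by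
    refine Finset.prod_eq_one fun t _ => ?_
    by_cases ht : t = s
    · subst ht; rw [h, I_phase]
    · simp [ht, phase_I]
  rw [h1, one_smul]
  congr 1
  funext t
  by_cases ht : t = s
  · subst ht; simp [h, I_mul]
  · simp [ht, mul_I]

/-- The linear combination of the products of symbols with the coefficients `c`. -/
noncomputable def toOp : (Config N → ℝ) →ₗ[ℝ] Operator N where
  toFun c := ∑ P, c P • pauliOp P
  map_add' c d := by simp [add_smul, Finset.sum_add_distrib]
  map_smul' a c := by simp [mul_smul, Finset.smul_sum]

theorem toOp_apply (c : Config N → ℝ) : toOp c = ∑ P, c P • pauliOp P := rfl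

theorem toOp_single (P : Config N) : toOp (Pi.single P 1) = pauliOp P := by
  rw [toOp_apply, Finset.sum_eq_single P]
  · simp
  · intro Q _ hQ; simp [hQ]
  · simp

theorem prod_phase_self (P : Config N) : ∏ s, phase (P s) (P s) = 1 :=
  Finset.prod_eq_one fun _ _ => phase_self _

/-- Pauli products are orthogonal for the trace form: the trace against `pauliOp Q` isolates `c Q`.
-/
theorem toOp_injective : Function.Injective (toOp : (Config N → ℝ) →ₗ[ℝ] Operator N) := by
  rw [← LinearMap.ker_eq_bot, LinearMap.ker_eq_bot']
  intro c hc
  funext Q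
  have h : (toOp c * pauliOp Q).trace = 0 := by rw [hc]; simp
  rw [toOp_apply, Finset.sum_mul, Matrix.trace_sum, Finset.sum_eq_single Q] at h
  · rw [smul_mul_assoc, Matrix.trace_smul, pauliOp_mul, prod_phase_self, one_smul, trace_pauliOp,
      if_pos ((mul_eq_I_config_iff Q Q).2 rfl)] at h
    simpa using h
  · intro P _ hP
    rw [smul_mul_assoc, Matrix.trace_smul, pauliOp_mul, Matrix.trace_smul, trace_pauliOp,
      if_neg (mt (mul_eq_I_config_iff P Q).1 hP)]
    simp
  · simp

/-- The configuration with `u` on the site `s` and `e` on the site `s + 1`. -/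
def bondConfig (u e : PauliSymbol) (s : ZMod N) : Config N :=
  fun t => if t = s then u else if t = s + 1 then e else I

theorem siteOp_mul_siteOp (hN : 2 ≤ N) (u e : PauliSymbol) (s : ZMod N) :
    siteOp u s * siteOp e (s + 1) = pauliOp (bondConfig u e s) := by
  have hne := self_ne_add_one hN s
  rw [siteOp_eq_pauliOp u, pauliOp_mul_siteOp _ _ _ (by simp [hne.symm])]
  congr 1
  funext t
  by_cases h1 : t = s
  · subst h1; simp [bondConfig, hne]
  · by_cases h2 : t = s + 1
    · subst h2; simp [bondConfig, hne.symm]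
    · simp [bondConfig, h1, h2]

/-- Both orders of multiplication give the same product of symbols, and their phases differ only
through the two sites of the bond. Apart from the common factor 2i the result is real, so the
coefficients stay real. -/
theorem pauliOp_commutator_bond (hN : 2 ≤ N) (P : Config N) (u e : PauliSymbol) (s : ZMod N) :
    pauliOp P * pauliOp (bondConfig u e s) - pauliOp (bondConfig u e s) * pauliOp P =
      (2 * Complex.I) •
        ((weight (P s) (P (s + 1)) u e : ℝ) • pauliOp (P * bondConfig u e s)) := by
  have hne := self_ne_add_one hN s
  have h1 : ∏ t, phase (P t) (bondConfig u e s t) = phase (P s) u * phase (P (s + 1)) e := by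
    rw [Finset.prod_eq_mul s (s + 1) hne]
    · simp [bondConfig, hne.symm]
    · intro t _ ht; simp [bondConfig, ht.1, ht.2, phase_I]
    · simp
    · simp
  have h2 : ∏ t, phase (bondConfig u e s t) (P t) = phase u (P s) * phase e (P (s + 1)) := by
    rw [Finset.prod_eq_mul s (s + 1) hne]
    · simp [bondConfig, hne.symm]
    · intro t _ ht; simp [bondConfig, ht.1, ht.2, I_phase]
    · simp
    · simp
  have h3 : bondConfig u e s * P = P * bondConfig u e s := funext fun t => mul_comm' _ _
  rw [pauliOp_mul, pauliOp_mul, h3, ← sub_smul, h1, h2, phase_commutator,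
    ← Complex.coe_smul, smul_smul]
  simp

/-- The Hamiltonian `∑ j, (J₁ u₁_j e₁_{j+1} + J₂ u₂_j e₂_{j+1})`. -/
noncomputable def bondHamiltonian (N : ℕ) [NeZero N] (J₁ : ℝ) (u₁ e₁ : PauliSymbol) (J₂ : ℝ)
    (u₂ e₂ : PauliSymbol) : Operator N :=
  ∑ j : ZMod N, ((J₁ : ℂ) • (siteOp u₁ j * siteOp e₁ (j + 1))
    + (J₂ : ℂ) • (siteOp u₂ j * siteOp e₂ (j + 1)))

/-- The contribution of the bond operator `u_s e_{s+1}` to the coefficient of `R` in the commutator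
of the operator with coefficients `c` and the Hamiltonian. -/
def bondTerm (c : Config N → ℝ) (J : ℝ) (u e : PauliSymbol) (R : Config N) (s : ZMod N) : ℝ :=
  J * weight (R s * u) (R (s + 1) * e) u e * c (R * bondConfig u e s)

/-- The operator with coefficients `c` commutes with the Hamiltonian. -/
def IsStationary (c : Config N → ℝ) (J₁ : ℝ) (u₁ e₁ : PauliSymbol) (J₂ : ℝ)
    (u₂ e₂ : PauliSymbol) : Prop :=
  ∀ R : Config N, ∑ s, (bondTerm c J₁ u₁ e₁ R s + bondTerm c J₂ u₂ e₂ R s) = 0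

theorem toOp_commutator_bond (hN : 2 ≤ N) (c : Config N → ℝ) (J : ℝ) (u e : PauliSymbol)
    (s : ZMod N) :
    ⁅toOp c, (J : ℂ) • (siteOp u s * siteOp e (s + 1))⁆ =
      (2 * Complex.I) • toOp fun R => bondTerm c J u e R s := by
  have hne := self_ne_add_one hN s
  have hinv (P : Config N) : P * bondConfig u e s * bondConfig u e s = P :=
    funext fun t => mul_mul_self _ _
  let σ : Config N ≃ Config N := ⟨(· * bondConfig u e s), (· * bondConfig u e s), hinv, hinv⟩
  rw [siteOp_mul_siteOp hN, Ring.lie_def, toOp_apply, toOp_apply, Finset.sum_mul, Finset.mul_sum,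
    ← Finset.sum_sub_distrib, Finset.smul_sum]
  refine Fintype.sum_equiv σ _ _ fun P => ?_
  have h := pauliOp_commutator_bond hN P u e s
  have hs : σ P = P * bondConfig u e s := rfl
  have h1 : (P * bondConfig u e s) s * u = P s := by simp [bondConfig, mul_mul_self]
  have h2 : (P * bondConfig u e s) (s + 1) * e = P (s + 1) := by
    simp [bondConfig, mul_mul_self, hne.symm]
  simp only [hs, bondTerm, h1, h2, hinv]
  rw [Complex.coe_smul, smul_mul_smul_comm, smul_mul_smul_comm, mul_comm J, ← smul_sub, h,
    smul_comm, smul_smul]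
  congr 2
  ring

theorem isStationary_iff (hN : 2 ≤ N) (c : Config N → ℝ) (J₁ : ℝ) (u₁ e₁ : PauliSymbol) (J₂ : ℝ)
    (u₂ e₂ : PauliSymbol) :
    IsStationary c J₁ u₁ e₁ J₂ u₂ e₂ ↔ ⁅toOp c, bondHamiltonian N J₁ u₁ e₁ J₂ u₂ e₂⁆ = 0 := by
  have h : ⁅toOp c, bondHamiltonian N J₁ u₁ e₁ J₂ u₂ e₂⁆ = (2 * Complex.I) •
      toOp fun R => ∑ s, (bondTerm c J₁ u₁ e₁ R s + bondTerm c J₂ u₂ e₂ R s) := by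
    have h1 : (fun R => ∑ s, (bondTerm c J₁ u₁ e₁ R s + bondTerm c J₂ u₂ e₂ R s)) =
        ∑ s, ((fun R => bondTerm c J₁ u₁ e₁ R s) + fun R => bondTerm c J₂ u₂ e₂ R s) := by
      funext R; simp
    rw [h1, map_sum, Finset.smul_sum, bondHamiltonian, Ring.lie_def, Finset.mul_sum, Finset.sum_mul,
      ← Finset.sum_sub_distrib]
    refine Finset.sum_congr rfl fun s _ => ?_
    rw [map_add, smul_add, ← toOp_commutator_bond hN, ← toOp_commutator_bond hN, Ring.lie_def,
      Ring.lie_def, mul_add, add_mul, add_sub_add_comm]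
  rw [h, smul_eq_zero, or_iff_right (by simp [Complex.I_ne_zero]),
    map_eq_zero_iff _ toOp_injective, IsStationary, funext_iff]
  rfl

/-- The coefficients of the Hamiltonian. -/
noncomputable def bondCoeff (J₁ : ℝ) (u₁ e₁ : PauliSymbol) (J₂ : ℝ) (u₂ e₂ : PauliSymbol) :
    Config N → ℝ :=
  ∑ s, (J₁ • Pi.single (bondConfig u₁ e₁ s) 1 + J₂ • Pi.single (bondConfig u₂ e₂ s) 1)

theorem toOp_bondCoeff (hN : 2 ≤ N) (J₁ : ℝ) (u₁ e₁ : PauliSymbol) (J₂ : ℝ)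
    (u₂ e₂ : PauliSymbol) :
    toOp (bondCoeff J₁ u₁ e₁ J₂ u₂ e₂) = bondHamiltonian N J₁ u₁ e₁ J₂ u₂ e₂ := by
  rw [bondCoeff, map_sum, bondHamiltonian]
  refine Finset.sum_congr rfl fun s _ => ?_
  rw [map_add, map_smul, map_smul, toOp_single, toOp_single, siteOp_mul_siteOp hN,
    siteOp_mul_siteOp hN, Complex.coe_smul, Complex.coe_smul]

end Operators

/-! ### Strings on the ring, and the bonds that contribute to their equations. -/

namespace PauliSymbol

/-- Before the multiplication the two sites carry `I` and `e`, which commute with the bond. This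
rules out bonds that would create a symbol out of a shorter string while overlapping it in their own
symbol. -/
theorem weight_of_eq_left {A u e : PauliSymbol} (h : A = u) : weight (A * u) (I * e) u e = 0 := by
  subst h; revert A e; decide

theorem weight_of_eq_right {A u e : PauliSymbol} (h : A = e) : weight (I * u) (A * e) u e = 0 := by
  subst h; revert A u; decide

theorem weight_I_I (u e : PauliSymbol) : weight (I * u) (I * e) u e = 0 := by
  revert u e; decide

theorem mul_self (A : PauliSymbol) : A * A = I := by cases A <;> rfl

theorem mul_ne_I {A B : PauliSymbol} (h : A ≠ B) : A * B ≠ I := mt (mul_eq_I_iff A B).1 h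

end PauliSymbol

section Place

variable {N : ℕ}

/-- The configuration with the symbol `f i` on the site `j + i` for `i < N`. -/
def place (j : ZMod N) (f : ℕ → PauliSymbol) : Config N := fun s => f (s - j).val

theorem place_add (j : ZMod N) (f : ℕ → PauliSymbol) {i : ℕ} (hi : i < N) :
    place j f (j + i) = f i := by
  rw [place, add_sub_cancel_left, ZMod.val_natCast_of_lt hi]

theorem add_natCast_inj (j : ZMod N) {a b : ℕ} (ha : a < N) (hb : b < N) :
    j + (a : ZMod N) = j + b ↔ a = b := by
  rw [add_right_inj]
  refine ⟨fun h => ?_, fun h => h ▸ rfl⟩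
  rw [← ZMod.val_natCast_of_lt ha, h, ZMod.val_natCast_of_lt hb]

/-- The coefficients `c` vanish outside the configurations supported in an arc of `k` sites. -/
def IsArcSupported (k : ℕ) (c : Config N → ℝ) : Prop :=
  ∀ P, c P ≠ 0 → ∃ a : ZMod N, ∀ s, P s ≠ I → (s - a).val < k

theorem IsArcSupported.mono {k l : ℕ} (h : k ≤ l) {c : Config N → ℝ} (hc : IsArcSupported k c) :
    IsArcSupported l c := fun P hP =>
  let ⟨a, ha⟩ := hc P hP
  ⟨a, fun s hs => (ha s hs).trans_le h⟩

variable [NeZero N]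

theorem exists_eq_add (j s : ZMod N) : ∃ i < N, s = j + (i : ℕ) :=
  ⟨(s - j).val, ZMod.val_lt _, by simp⟩

theorem place_congr (j : ZMod N) {f g : ℕ → PauliSymbol} (h : ∀ i < N, f i = g i) :
    place j f = place j g :=
  funext fun _ => h _ (ZMod.val_lt _)

/-- The site `j` is position 0 counted from `j` and position `N - 1` counted from `j + 1`; this is
why both must carry `I`. -/
theorem place_shift (j : ZMod N) {f g : ℕ → PauliSymbol} (h0 : f 0 = I)
    (h : ∀ i, i + 1 < N → f (i + 1) = g i) (hlast : g (N - 1) = I) :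
    place j f = place (j + 1) g := by
  have hN : 0 < N := Nat.pos_of_ne_zero (NeZero.ne N)
  funext s
  obtain ⟨i, hi, rfl⟩ := exists_eq_add (j + 1) s
  rw [place_add _ _ hi]
  by_cases h1 : i + 1 < N
  · have : j + 1 + (i : ZMod N) = j + ((i + 1 : ℕ) : ZMod N) := by push_cast; ring
    rw [this, place_add _ _ h1, h i h1]
  · have h2 : i + 1 = N := by omega
    have : j + 1 + (i : ZMod N) = j + ((0 : ℕ) : ZMod N) := by
      rw [add_assoc, add_comm (1 : ZMod N), ← Nat.cast_add_one, h2]; simp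
    rw [this, place_add _ _ hN, h0]
    rw [← h2, Nat.add_sub_cancel] at hlast
    exact hlast.symm

theorem sum_eq_sum_range (j : ZMod N) (F : ZMod N → ℝ) :
    ∑ s, F s = ∑ i ∈ Finset.range N, F (j + (i : ZMod N)) := by
  refine Finset.sum_nbij' (fun s => (s - j).val) (fun i => j + (i : ZMod N)) ?_ ?_ ?_ ?_ ?_
  · intro s _; exact Finset.mem_range.2 (ZMod.val_lt _)
  · simp
  · intro s _; simp
  · intro i hi; simp [ZMod.val_natCast_of_lt (Finset.mem_range.1 hi)]
  · intro s _; simp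

/-- Multiplication of a string by the bond operator `u e` at the positions `i`, `i + 1`. -/
def mulBond (f : ℕ → PauliSymbol) (u e : PauliSymbol) (i : ℕ) : ℕ → PauliSymbol :=
  fun m => if m = i then f m * u else if m = i + 1 then f m * e else f m

theorem place_mul_bondConfig (j : ZMod N) (f : ℕ → PauliSymbol) (u e : PauliSymbol) {i : ℕ}
    (hi : i + 1 < N) :
    place j f * bondConfig u e (j + (i : ZMod N)) = place j (mulBond f u e i) := by
  funext s
  obtain ⟨m, hm, rfl⟩ := exists_eq_add j s
  have h1 : j + (i : ZMod N) + 1 = j + ((i + 1 : ℕ) : ZMod N) := by push_cast; ring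
  rw [Pi.mul_apply, place_add _ _ hm, place_add _ _ hm, bondConfig, mulBond, h1]
  simp only [add_natCast_inj j hm hi, add_natCast_inj j hm (Nat.lt_of_succ_lt hi)]
  split_ifs <;> simp [mul_I]

theorem bondTerm_place (c : Config N → ℝ) (J : ℝ) (u e : PauliSymbol) (j : ZMod N)
    (f : ℕ → PauliSymbol) {i : ℕ} (hi : i + 1 < N) :
    bondTerm c J u e (place j f) (j + (i : ZMod N)) =
      J * weight (f i * u) (f (i + 1) * e) u e * c (place j (mulBond f u e i)) := by
  have h1 : j + (i : ZMod N) + 1 = j + ((i + 1 : ℕ) : ZMod N) := by push_cast; ring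
  rw [bondTerm, place_mul_bondConfig j f u e hi, h1, place_add _ _ hi,
    place_add _ _ (Nat.lt_of_succ_lt hi)]

theorem bondTerm_place_wrap (c : Config N → ℝ) (J : ℝ) (u e : PauliSymbol) (j : ZMod N)
    (f : ℕ → PauliSymbol) :
    bondTerm c J u e (place j f) (j + ((N - 1 : ℕ) : ZMod N)) =
      J * weight (f (N - 1) * u) (f 0 * e) u e *
        c (place j f * bondConfig u e (j + ((N - 1 : ℕ) : ZMod N))) := by
  have hN : 0 < N := Nat.pos_of_ne_zero (NeZero.ne N)
  have h1 : j + ((N - 1 : ℕ) : ZMod N) + 1 = j + ((0 : ℕ) : ZMod N) := by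
    rw [add_assoc, ← Nat.cast_add_one, Nat.sub_add_cancel hN]; simp
  rw [bondTerm, h1, place_add _ _ hN, place_add _ _ (Nat.sub_lt hN one_pos)]

theorem place_mul_bondConfig_wrap (j : ZMod N) (f : ℕ → PauliSymbol) (u e : PauliSymbol) {i : ℕ}
    (hi : i < N) :
    (place j f * bondConfig u e (j + ((N - 1 : ℕ) : ZMod N))) (j + (i : ZMod N)) =
      f i * if i + 1 = N then u else if i = 0 then e else I := by
  have hN : 0 < N := Nat.pos_of_ne_zero (NeZero.ne N)
  have h1 : j + ((N - 1 : ℕ) : ZMod N) + 1 = j + ((0 : ℕ) : ZMod N) := by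
    rw [add_assoc, ← Nat.cast_add_one, Nat.sub_add_cancel hN]; simp
  have h2 : i = N - 1 ↔ i + 1 = N := by omega
  rw [Pi.mul_apply, place_add _ _ hi, bondConfig, h1]
  simp only [add_natCast_inj j hi (Nat.sub_lt hN one_pos), add_natCast_inj j hi hN, h2]

/-- Two sites at distance `k` fit into no arc of `k` sites, because `k + k ≤ N` excludes going round
the ring. -/
theorem IsArcSupported.eq_zero {k : ℕ} (hk : 2 * k ≤ N) {c : Config N → ℝ}
    (hc : IsArcSupported k c) {P : Config N} (s : ZMod N) (h1 : P s ≠ I)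
    (h2 : P (s + (k : ℕ)) ≠ I) : c P = 0 := by
  by_contra h
  obtain ⟨a, ha⟩ := hc P h
  have h3 := ha _ h1
  have h4 := ha _ h2
  have h5 : s + (k : ZMod N) - a = (((s - a).val + k : ℕ) : ZMod N) := by
    push_cast; rw [ZMod.natCast_zmod_val]; ring
  rw [h5, ZMod.val_natCast_of_lt (by omega)] at h4
  omega

theorem IsArcSupported.place_eq_zero {k : ℕ} (hk : 2 * k ≤ N) {c : Config N → ℝ}
    (hc : IsArcSupported k c) (j : ZMod N) {f : ℕ → PauliSymbol} (i : ℕ) (hi : i + k < N)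
    (h1 : f i ≠ I) (h2 : f (i + k) ≠ I) : c (place j f) = 0 := by
  refine hc.eq_zero hk (j + (i : ZMod N)) ?_ ?_
  · rwa [place_add _ _ (by omega)]
  · rwa [add_assoc, ← Nat.cast_add, place_add _ _ hi]

/-- Removal of the first symbol of a string by a bond operator with second symbol `e`. -/
def lstrip (g : ℕ → PauliSymbol) (e : PauliSymbol) : ℕ → PauliSymbol :=
  fun i => if i = 0 then g 1 * e else g (i + 1)

/-- Removal of the symbol at the last position `k` of a string by a bond operator with first
symbol `u`. -/
def rstrip (g : ℕ → PauliSymbol) (k : ℕ) (u : PauliSymbol) : ℕ → PauliSymbol :=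
  fun i => if i + 1 = k then g i * u else if i = k then I else g i

/-- The contribution to the coefficient of a string of the string without its first symbol. -/
def leftTerm (c : Config N → ℝ) (J : ℝ) (u e : PauliSymbol) (j : ZMod N) (g : ℕ → PauliSymbol) :
    ℝ :=
  if g 0 = u then J * weight I (g 1 * e) u e * c (place (j + 1) (lstrip g e)) else 0

/-- The contribution to the coefficient of a string of the string without its last symbol. -/
def rightTerm (c : Config N → ℝ) (J : ℝ) (u e : PauliSymbol) (j : ZMod N) (k : ℕ)
    (g : ℕ → PauliSymbol) : ℝ :=
  if g k = e then J * weight (g (k - 1) * u) I u e * c (place j (rstrip g k u)) else 0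

/-- The value `g N` lies beyond the ring but is read by `lstrip` at position `N - 1`, so it has to
be `I`. -/
theorem bondTerm_eq_leftTerm (hN : 2 ≤ N) (c : Config N → ℝ) (J : ℝ) (u e : PauliSymbol)
    (j : ZMod N) (g : ℕ → PauliSymbol) (hg : g N = I) (h0 : g 0 = u) :
    bondTerm c J u e (place j g) (j + ((0 : ℕ) : ZMod N)) = leftTerm c J u e j g := by
  rw [bondTerm_place _ _ _ _ _ _ (by omega), leftTerm, if_pos h0, h0, mul_self]
  congr 2
  refine place_shift j ?_ ?_ ?_
  · simp [mulBond, h0, mul_self]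
  · intro i _
    by_cases h : i = 0 <;> simp [mulBond, lstrip, h]
  · simp [lstrip, Nat.sub_add_cancel (by omega : 1 ≤ N), hg]
    omega

theorem bondTerm_eq_rightTerm (c : Config N → ℝ) (J : ℝ) (u e : PauliSymbol) (j : ZMod N) (k : ℕ)
    (hk : 1 ≤ k) (hkN : k < N) (g : ℕ → PauliSymbol) (h0 : g k = e) :
    bondTerm c J u e (place j g) (j + ((k - 1 : ℕ) : ZMod N)) = rightTerm c J u e j k g := by
  obtain ⟨k, rfl⟩ : ∃ l, k = l + 1 := ⟨k - 1, by omega⟩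
  rw [Nat.add_sub_cancel, bondTerm_place _ _ _ _ _ _ (by omega), rightTerm, if_pos h0,
    Nat.add_sub_cancel, h0, mul_self]
  congr 2
  refine place_congr j fun i _ => ?_
  simp only [mulBond, rstrip, Nat.add_right_cancel_iff]
  split_ifs with h1 h2
  · rfl
  · rw [h2, h0, mul_self]
  · rfl

variable {c : Config N → ℝ} {k : ℕ}

/-- A bond that removes neither end leaves symbols at distance `k`, unless it commutes with the
string it is applied to. -/
theorem bondTerm_top_of_ne (hk2 : 2 ≤ k) (hk : 2 * k ≤ N) (hc : IsArcSupported k c) (J : ℝ)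
    {u e : PauliSymbol} (j : ZMod N) {g : ℕ → PauliSymbol} (hg : ∀ i, k < i → g i = I)
    (h0 : g 0 ≠ I) (hl : g k ≠ I) {i : ℕ} (hi : i < N) (hi0 : i = 0 → g 0 ≠ u)
    (hik : i + 1 = k → g k ≠ e) : bondTerm c J u e (place j g) (j + (i : ZMod N)) = 0 := by
  by_cases hw : i + 1 = N
  · have hi' : i = N - 1 := by omega
    rw [hi', bondTerm_place_wrap]
    by_cases he : g 0 = e
    · rw [hg _ (by omega), weight_of_eq_right he]; simp
    · rw [hc.eq_zero hk (j + ((0 : ℕ) : ZMod N)), mul_zero]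
      · rw [place_mul_bondConfig_wrap _ _ _ _ (by omega), if_neg (by omega), if_pos rfl]
        exact mul_ne_I he
      · rw [add_assoc, ← Nat.cast_add, place_mul_bondConfig_wrap _ _ _ _ (by omega),
          if_neg (by omega), if_neg (by omega), mul_I, zero_add]
        exact hl
  rw [bondTerm_place _ _ _ _ _ _ (by omega)]
  by_cases h1 : k < i
  · rw [hg _ h1, hg _ (by omega), weight_I_I]; simp
  by_cases h2 : i = k ∧ g k = u
  · rw [h2.1, hg (k + 1) (by omega), weight_of_eq_left h2.2]; simp
  rw [hc.place_eq_zero hk j 0 (by omega), mul_zero]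
  · simp only [mulBond]
    split_ifs with h h'
    · exact mul_ne_I (hi0 h.symm)
    · exact h'.elim
    · exact h0
  · rw [zero_add]
    simp only [mulBond]
    split_ifs with h h'
    · exact mul_ne_I fun h3 => h2 ⟨h.symm, h3⟩
    · exact mul_ne_I (hik h'.symm)
    · exact hl

variable {J₁ J₂ : ℝ} {u₁ e₁ u₂ e₂ : PauliSymbol}

/-- Only the removal of the first or of the last symbol contributes to the coefficient of a string
of length `k + 1`. -/
theorem IsStationary.top (hs : IsStationary c J₁ u₁ e₁ J₂ u₂ e₂) (hk2 : 2 ≤ k) (hk : 2 * k ≤ N)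
    (hc : IsArcSupported k c) (j : ZMod N) {g : ℕ → PauliSymbol} (hg : ∀ i, k < i → g i = I)
    (h0 : g 0 ≠ I) (hl : g k ≠ I) :
    (leftTerm c J₁ u₁ e₁ j g + leftTerm c J₂ u₂ e₂ j g) +
      (rightTerm c J₁ u₁ e₁ j k g + rightTerm c J₂ u₂ e₂ j k g) = 0 := by
  have hleft (J : ℝ) (u e : PauliSymbol) :
      bondTerm c J u e (place j g) (j + ((0 : ℕ) : ZMod N)) = leftTerm c J u e j g := by
    by_cases h : g 0 = u
    · exact bondTerm_eq_leftTerm (by omega) c J u e j g (hg _ (by omega)) h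
    · rw [leftTerm, if_neg h]
      exact bondTerm_top_of_ne hk2 hk hc J j hg h0 hl (by omega) (fun _ => h) (by omega)
  have hright (J : ℝ) (u e : PauliSymbol) :
      bondTerm c J u e (place j g) (j + ((k - 1 : ℕ) : ZMod N)) = rightTerm c J u e j k g := by
    by_cases h : g k = e
    · exact bondTerm_eq_rightTerm c J u e j k (by omega) (by omega) g h
    · rw [rightTerm, if_neg h]
      exact bondTerm_top_of_ne hk2 hk hc J j hg h0 hl (by omega) (by omega) fun _ => h
  have h := hs (place j g)
  rw [sum_eq_sum_range j, Finset.sum_eq_add 0 (k - 1) (by omega)] at h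
  · rwa [hleft, hleft, hright, hright] at h
  · intro i hi hne
    have hi' := Finset.mem_range.1 hi
    rw [bondTerm_top_of_ne hk2 hk hc J₁ j hg h0 hl hi' (by omega) (by omega),
      bondTerm_top_of_ne hk2 hk hc J₂ j hg h0 hl hi' (by omega) (by omega), add_zero]
  · intro h; simp at h; omega
  · intro h; simp at h; omega

/-- Bond operators that stick out of a string of length `k` do not contribute to its coefficient. -/
theorem bondTerm_outside (hk2 : 2 ≤ k) (hk : 2 * k ≤ N) (hc : IsArcSupported k c) (J : ℝ)
    {u e : PauliSymbol} (hu : u ≠ I) (he : e ≠ I) (j : ZMod N) {g : ℕ → PauliSymbol}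
    (hg : ∀ i, k ≤ i → g i = I) (h0 : g 0 ≠ I) (hl : g (k - 1) ≠ I) {i : ℕ} (hi : i < N)
    (hki : k ≤ i + 1) : bondTerm c J u e (place j g) (j + (i : ZMod N)) = 0 := by
  by_cases hw : i + 1 = N
  · have hi' : i = N - 1 := by omega
    rw [hi', bondTerm_place_wrap, hg _ (by omega)]
    by_cases he : g 0 = e
    · rw [weight_of_eq_right he]; simp
    · rw [hc.eq_zero hk (j + ((N - 1 : ℕ) : ZMod N)), mul_zero]
      · rw [place_mul_bondConfig_wrap _ _ _ _ (by omega), if_pos (by omega), hg _ (by omega),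
          I_mul]
        exact hu
      · have h1 : j + ((N - 1 : ℕ) : ZMod N) + k = j + ((k - 1 : ℕ) : ZMod N) := by
          rw [add_assoc, ← Nat.cast_add, show N - 1 + k = N + (k - 1) by omega, Nat.cast_add]
          simp
        rw [h1, place_mul_bondConfig_wrap _ _ _ _ (by omega), if_neg (by omega),
          if_neg (by omega), mul_I]
        exact hl
  rw [bondTerm_place _ _ _ _ _ _ (by omega), hg _ (by omega : k ≤ i + 1)]
  by_cases h1 : k ≤ i
  · rw [hg _ h1, weight_I_I]; simp
  by_cases h2 : g i = u
  · rw [weight_of_eq_left h2]; simp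
  rw [hc.place_eq_zero hk j 0 (by omega), mul_zero]
  · rw [mulBond, if_neg (by omega), if_neg (by omega)]; exact h0
  · rw [zero_add, mulBond, if_neg (by omega), if_pos (by omega), hg _ le_rfl, I_mul]
    exact he

/-- Only bond operators inside a string of length `k` contribute to its coefficient. -/
theorem IsStationary.inside (hs : IsStationary c J₁ u₁ e₁ J₂ u₂ e₂) (hu₁ : u₁ ≠ I) (he₁ : e₁ ≠ I)
    (hu₂ : u₂ ≠ I) (he₂ : e₂ ≠ I) (hk2 : 2 ≤ k) (hk : 2 * k ≤ N) (hc : IsArcSupported k c)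
    (j : ZMod N) {g : ℕ → PauliSymbol} (hg : ∀ i, k ≤ i → g i = I) (h0 : g 0 ≠ I)
    (hl : g (k - 1) ≠ I) :
    ∑ i ∈ Finset.range (k - 1), (bondTerm c J₁ u₁ e₁ (place j g) (j + (i : ZMod N)) +
      bondTerm c J₂ u₂ e₂ (place j g) (j + (i : ZMod N))) = 0 := by
  have h := hs (place j g)
  rw [sum_eq_sum_range j] at h
  rw [← h]
  refine Finset.sum_subset (Finset.range_subset_range.2 (by omega)) fun i hi hi' => ?_
  rw [Finset.mem_range] at hi hi'
  rw [bondTerm_outside hk2 hk hc J₁ hu₁ he₁ j hg h0 hl hi (by omega),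
    bondTerm_outside hk2 hk hc J₂ hu₂ he₂ j hg h0 hl hi (by omega), add_zero]

end Place

/-! ### Shifts of strings of maximal length. -/

namespace PauliSymbol

theorem weight_I_right (A u e : PauliSymbol) : weight A I u e = sgn A u := by
  revert A u e; decide

theorem weight_I_mul_self (u e : PauliSymbol) : weight I (e * e) u e = 0 := by
  revert u e; decide

theorem weight_I_I_mul (u e : PauliSymbol) : weight I (I * e) u e = 0 := by
  revert u e; decide

theorem sgn_ne_zero {A B : PauliSymbol} (hA : A ≠ I) (hB : B ≠ I) (h : A ≠ B) : sgn A B ≠ 0 := by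
  revert A B; decide

end PauliSymbol

section Strings

variable {N : ℕ}

theorem rightTerm_of_ne {c : Config N → ℝ} {k : ℕ} (J : ℝ) {u e : PauliSymbol} (j : ZMod N) {g : ℕ → PauliSymbol}
    (h : g k ≠ e) : rightTerm c J u e j k g = 0 := if_neg h

theorem leftTerm_of_ne {c : Config N → ℝ} (J : ℝ) {u e : PauliSymbol} (j : ZMod N) {g : ℕ → PauliSymbol}
    (h : g 0 ≠ u) : leftTerm c J u e j g = 0 := if_neg h

/-- `f` is a string of length exactly `k`. -/
structure IsString (k : ℕ) (f : ℕ → PauliSymbol) : Prop where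
  first : f 0 ≠ I
  last : f (k - 1) ≠ I
  outside : ∀ i, k ≤ i → f i = I

/-- Multiplication of a string of length `k` by a bond operator `b e` that sticks out on the
right. -/
def extend (f : ℕ → PauliSymbol) (k : ℕ) (b e : PauliSymbol) : ℕ → PauliSymbol :=
  fun i => if i + 1 = k then f i * b else if i = k then e else f i

theorem rightTerm_extend {c : Config N → ℝ} {k : ℕ} (hk2 : 2 ≤ k) (J : ℝ) (b e : PauliSymbol) (j : ZMod N)
    {f : ℕ → PauliSymbol} (hf : IsString k f) :
    rightTerm c J b e j k (extend f k b e) = J * sgn (f (k - 1)) b * c (place j f) := by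
  have h1 : extend f k b e k = e := by simp [extend]
  have h2 : extend f k b e (k - 1) * b = f (k - 1) := by
    rw [extend, if_pos (by omega), mul_mul_self]
  have h3 : rstrip (extend f k b e) k b = f := by
    funext i
    simp only [rstrip, extend]
    split_ifs with h h'
    · exact mul_mul_self _ _
    · rw [h', hf.outside _ le_rfl]
    · rfl
  rw [rightTerm, if_pos h1, h2, h3, weight_I_right]

/-- If `g 1` is `e` or `I`, the pair before multiplication is `I I` or `I e`, and both commute with
the bond. -/
theorem leftTerm_eq_zero {c : Config N → ℝ} (J : ℝ) {u e : PauliSymbol} (j : ZMod N) {g : ℕ → PauliSymbol}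
    (h : g 0 = u → g 1 ≠ e → g 1 ≠ I → c (place (j + 1) (lstrip g e)) = 0) :
    leftTerm c J u e j g = 0 := by
  rw [leftTerm]
  split_ifs with h0
  · by_cases h1 : g 1 = e
    · rw [h1, weight_I_mul_self]; simp
    by_cases h2 : g 1 = I
    · rw [h2, weight_I_I_mul]; simp
    rw [h h0 h1 h2, mul_zero]
  · rfl

variable [NeZero N]

/-- Coefficients, supported in arcs of `k` sites, of an operator that commutes with
`∑ j, (J₁ X_j Y_{j+1} + J₂ w_j Z_{j+1})`. -/
structure IsLocalStationary (w : PauliSymbol) (J₁ J₂ : ℝ) (k : ℕ) (c : Config N → ℝ) : Prop where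
  stationary : IsStationary c J₁ X Y J₂ w Z
  symbol : w = Y ∨ w = Z
  ne_zero₁ : J₁ ≠ 0
  ne_zero₂ : J₂ ≠ 0
  two_le : 2 ≤ k
  two_mul_le : 2 * k ≤ N
  arc : IsArcSupported k c

theorem isString_lstrip_extend {k : ℕ} (hk : 2 ≤ k) {f : ℕ → PauliSymbol} (hf : IsString k f)
    {b e' e : PauliSymbol} (he' : e' ≠ I) (h1 : extend f k b e' 1 ≠ e) :
    IsString k (lstrip (extend f k b e') e) := by
  refine ⟨?_, ?_, ?_⟩
  · simpa [lstrip] using mul_ne_I h1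
  · rw [lstrip, if_neg (by omega), extend, if_neg (by omega), if_pos (by omega)]
    exact he'
  · intro i hi
    rw [lstrip, if_neg (by omega), extend, if_neg (by omega), if_neg (by omega)]
    exact hf.outside _ (by omega)

variable {w : PauliSymbol} {J₁ J₂ : ℝ} {k : ℕ} {c : Config N → ℝ}

namespace IsLocalStationary

theorem symbol_ne_I (h : IsLocalStationary w J₁ J₂ k c) : w ≠ I := by
  rcases h.symbol with rfl | rfl <;> decide

theorem symbol_ne_X (h : IsLocalStationary w J₁ J₂ k c) : w ≠ X := by
  rcases h.symbol with rfl | rfl <;> decide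

/-- The extended string ends in `Y`, so `w Z` cannot be the bond attached on its right. -/
theorem extend_X (h : IsLocalStationary w J₁ J₂ k c) (j : ZMod N) {f : ℕ → PauliSymbol}
    (hf : IsString k f) :
    leftTerm c J₁ X Y j (extend f k X Y) + leftTerm c J₂ w Z j (extend f k X Y) +
      J₁ * sgn (f (k - 1)) X * c (place j f) = 0 := by
  have hk2 := h.two_le
  have h1 := h.stationary.top h.two_le h.two_mul_le h.arc j (g := extend f k X Y)
    (fun i hi => by
      rw [extend, if_neg (by omega), if_neg (by omega)]; exact hf.outside _ (by omega))
    (by rw [extend, if_neg (by omega), if_neg (by omega)]; exact hf.first)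
    (by simp [extend])
  rwa [rightTerm_extend h.two_le _ _ _ _ hf, rightTerm_of_ne _ _ (by simp [extend]), add_zero]
    at h1

theorem extend_symbol (h : IsLocalStationary w J₁ J₂ k c) (j : ZMod N) {f : ℕ → PauliSymbol}
    (hf : IsString k f) :
    leftTerm c J₁ X Y j (extend f k w Z) + leftTerm c J₂ w Z j (extend f k w Z) +
      J₂ * sgn (f (k - 1)) w * c (place j f) = 0 := by
  have hk2 := h.two_le
  have h1 := h.stationary.top h.two_le h.two_mul_le h.arc j (g := extend f k w Z)
    (fun i hi => by
      rw [extend, if_neg (by omega), if_neg (by omega)]; exact hf.outside _ (by omega))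
    (by rw [extend, if_neg (by omega), if_neg (by omega)]; exact hf.first)
    (by simp [extend])
  rwa [rightTerm_extend h.two_le _ _ _ _ hf, rightTerm_of_ne _ _ (by simp [extend]), zero_add]
    at h1

theorem eq_zero_of_extend_X (h : IsLocalStationary w J₁ J₂ k c) (j : ZMod N)
    {f : ℕ → PauliSymbol} (hf : IsString k f) (hl : f (k - 1) ≠ X)
    (h1 : leftTerm c J₁ X Y j (extend f k X Y) = 0)
    (h2 : leftTerm c J₂ w Z j (extend f k X Y) = 0) : c (place j f) = 0 := by
  have h3 := h.extend_X j hf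
  rw [h1, h2, add_zero, zero_add] at h3
  have := sgn_ne_zero hf.last (by decide) hl
  simpa [h.ne_zero₁, this] using h3

theorem eq_zero_of_extend_symbol (h : IsLocalStationary w J₁ J₂ k c) (j : ZMod N)
    {f : ℕ → PauliSymbol} (hf : IsString k f) (hl : f (k - 1) ≠ w)
    (h1 : leftTerm c J₁ X Y j (extend f k w Z) = 0)
    (h2 : leftTerm c J₂ w Z j (extend f k w Z) = 0) : c (place j f) = 0 := by
  have h3 := h.extend_symbol j hf
  rw [h1, h2, add_zero, zero_add] at h3
  have := sgn_ne_zero hf.last h.symbol_ne_I hl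
  simpa [h.ne_zero₂, this] using h3

/-- The coefficient of a string vanishes if those of all strings to which it is shifted do. -/
theorem eq_zero_of_shift (h : IsLocalStationary w J₁ J₂ k c) (hk3 : 3 ≤ k) (j : ZMod N)
    {f : ℕ → PauliSymbol} (hf : IsString k f)
    (H : ∀ f' e, IsString k f' → (f 0 = X ∧ e = Y ∨ f 0 = w ∧ e = Z) → f 1 ≠ I → f 1 ≠ e →
      f' 0 = f 1 * e → (∀ i, i + 3 < k → f' (i + 1) = f (i + 2)) → c (place (j + 1) f') = 0) :
    c (place j f) = 0 := by
  have hz (b e' : PauliSymbol) (he' : e' ≠ I) :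
      leftTerm c J₁ X Y j (extend f k b e') = 0 ∧ leftTerm c J₂ w Z j (extend f k b e') = 0 := by
    have h0 : extend f k b e' 0 = f 0 := by
      rw [extend, if_neg (by omega), if_neg (by omega)]
    have h1 : extend f k b e' 1 = f 1 := by
      rw [extend, if_neg (by omega), if_neg (by omega)]
    have h2 (e : PauliSymbol) (i : ℕ) (hi : i + 3 < k) :
        lstrip (extend f k b e') e (i + 1) = f (i + 2) := by
      rw [lstrip, if_neg (by omega), extend, if_neg (by omega), if_neg (by omega)]
    constructor
    · refine leftTerm_eq_zero _ _ fun g0 g1 g2 => ?_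
      exact H _ Y (isString_lstrip_extend h.two_le hf he' g1) (Or.inl ⟨h0 ▸ g0, rfl⟩) (h1 ▸ g2)
        (h1 ▸ g1) (by simp [lstrip, h1]) (h2 Y)
    · refine leftTerm_eq_zero _ _ fun g0 g1 g2 => ?_
      exact H _ Z (isString_lstrip_extend h.two_le hf he' g1) (Or.inr ⟨h0 ▸ g0, rfl⟩) (h1 ▸ g2)
        (h1 ▸ g1) (by simp [lstrip, h1]) (h2 Z)
  -- The last symbol cannot equal both `X` and `w`, so for at least one of the two extensions the
  -- factor of the coefficient is nonzero.
  by_cases hl : f (k - 1) = X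
  · exact h.eq_zero_of_extend_symbol j hf (hl ▸ h.symbol_ne_X.symm) (hz _ _ (by decide)).1
      (hz _ _ (by decide)).2
  · exact h.eq_zero_of_extend_X j hf hl (hz _ _ (by decide)).1 (hz _ _ (by decide)).2

/-- Neither bond can strip the first symbol, so the string has no shift. -/
theorem eq_zero_of_first (h : IsLocalStationary w J₁ J₂ k c) (hk3 : 3 ≤ k) (j : ZMod N)
    {f : ℕ → PauliSymbol} (hf : IsString k f) (h1 : f 0 ≠ X) (h2 : f 0 ≠ w) :
    c (place j f) = 0 :=
  h.eq_zero_of_shift hk3 j hf fun _ _ _ h3 => by tauto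

/-- Strings with an identity in their interior have coefficient zero. -/
theorem eq_zero_of_interior (h : IsLocalStationary w J₁ J₂ k c) {d : ℕ} (hd1 : 1 ≤ d)
    (hd : d + 2 ≤ k) (j : ZMod N) {f : ℕ → PauliSymbol} (hf : IsString k f) (hfd : f d = I) :
    c (place j f) = 0 := by
  -- Every shift moves the identity one position to the left. Once it is next to the first symbol,
  -- the left terms vanish.
  induction d, hd1 using Nat.le_induction generalizing j f with
  | base => exact h.eq_zero_of_shift (by omega) j hf fun _ _ _ _ h1 => absurd hfd h1
  | succ d hd1 ih =>
    refine h.eq_zero_of_shift (by omega) j hf fun f' e hf' _ _ _ _ h2 => ?_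
    refine ih (by omega) (j + 1) hf' ?_
    have := h2 (d - 1) (by omega)
    rwa [show d - 1 + 1 = d by omega, show d - 1 + 2 = d + 1 by omega, hfd] at this

end IsLocalStationary

/-- The string `X Z ⋯ Z Y` of length `k`. -/
def mainString (k : ℕ) : ℕ → PauliSymbol :=
  fun i => if i = 0 then X else if i + 1 < k then Z else if i + 1 = k then Y else I

theorem isString_mainString (hk : 2 ≤ k) : IsString k (mainString k) := by
  refine ⟨by simp [mainString], ?_, fun i hi => ?_⟩
  · rw [mainString, if_neg (by omega), if_neg (by omega), if_pos (by omega)]; decide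
  · rw [mainString, if_neg (by omega), if_neg (by omega), if_neg (by omega)]

theorem mainString_last (hk : 2 ≤ k) : mainString k (k - 1) = Y := by
  rw [mainString, if_neg (by omega), if_neg (by omega), if_pos (by omega)]

namespace IsLocalStationary

/-- The string is its own shift: on the right `Y * X = Z` followed by a new `Y`, on the left `Z * Y
= X`. -/
theorem mainString_succ (h : IsLocalStationary w J₁ J₂ k c) (j : ZMod N) :
    c (place (j + 1) (mainString k)) = c (place j (mainString k)) := by
  have hk2 := h.two_le
  have hl := mainString_last h.two_le
  have h1 := h.extend_X j (isString_mainString h.two_le)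
  have h0 : extend (mainString k) k X Y 0 = X := by
    rw [extend, if_neg (by omega), if_neg (by omega)]; rfl
  have h2 : extend (mainString k) k X Y 1 = Z := by
    simp only [extend, mainString]
    split_ifs <;> first | rfl | contradiction | omega
  have h3 : lstrip (extend (mainString k) k X Y) Y = mainString k := by
    funext i
    simp only [lstrip, h2]
    simp only [extend, mainString]
    split_ifs <;> first | rfl | contradiction | omega
  rw [leftTerm, if_pos h0, h2, h3, leftTerm_of_ne _ _ (by rw [h0]; exact h.symbol_ne_X.symm),
    hl, show weight I (Z * Y) X Y = 1 from rfl, show sgn Y X = -1 from rfl] at h1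
  have h4 : J₁ * (c (place (j + 1) (mainString k)) - c (place j (mainString k))) = 0 := by
    push_cast at h1; linarith
  exact sub_eq_zero.1 ((mul_eq_zero.1 h4).resolve_left h.ne_zero₁)

theorem mainString_const (h : IsLocalStationary w J₁ J₂ k c) (j : ZMod N) :
    c (place j (mainString k)) = c (place 0 (mainString k)) := by
  obtain ⟨i, -, rfl⟩ := exists_eq_add 0 j
  induction i with
  | zero => simp
  | succ i ih => rw [← ih, Nat.cast_add_one, ← add_assoc, h.mainString_succ]

/-- Extending by `X Y` turns a final `Y` into `Z Y`, so each shift enlarges by one the final segment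
that agrees with X Z⋯Z Y. The induction is on the number `t` of positions still unconstrained. -/
theorem eq_zero_of_agree (h : IsLocalStationary w J₁ J₂ k c)
    (hm : ∀ j, c (place j (mainString k)) = 0) {t : ℕ} (ht : t + 1 ≤ k) (j : ZMod N)
    {f : ℕ → PauliSymbol} (hf : IsString k f) (hft : ∀ i, t ≤ i → i < k → f i = mainString k i) :
    c (place j f) = 0 := by
  have hk2 := h.two_le
  have hmain {j : ZMod N} {f : ℕ → PauliSymbol} (hf : IsString k f)
      (h0 : ∀ i < k, f i = mainString k i) : c (place j f) = 0 := by
    rw [← hm j]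
    refine congrArg c (place_congr j fun i _ => ?_)
    by_cases hi : i < k
    · exact h0 i hi
    · rw [hf.outside _ (by omega), (isString_mainString h.two_le).outside _ (by omega)]
  induction t generalizing j f with
  | zero => exact hmain hf fun i hi => hft i (Nat.zero_le _) hi
  | succ t ih =>
    have hl : f (k - 1) = Y := by rw [hft _ (by omega) (by omega), mainString_last h.two_le]
    have h0 : extend f k X Y 0 = f 0 := by rw [extend, if_neg (by omega), if_neg (by omega)]
    rcases Nat.eq_zero_or_pos t with rfl | htpos
    · by_cases hX : f 0 = X
      · refine hmain hf fun i hi => ?_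
        rcases Nat.eq_zero_or_pos i with rfl | hi0
        · rw [hX]; rfl
        · exact hft i hi0 hi
      · have h1 : extend f k X Y 1 = Z := by
          have := hft 1 le_rfl (by omega)
          simp only [extend, this, mainString]
          split_ifs <;> first | rfl | contradiction | omega
        -- The second symbol is `Z`, so stripping by `w Z` would start from `I I`, which commutes
        -- with the bond.
        refine h.eq_zero_of_extend_X j hf (by rw [hl]; decide) (leftTerm_of_ne _ _ (by rwa [h0]))
          (leftTerm_eq_zero _ _ fun _ h2 => absurd h1 h2)
    · have hz (e : PauliSymbol) (he : extend f k X Y 1 ≠ e) :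
          c (place (j + 1) (lstrip (extend f k X Y) e)) = 0 := by
        refine ih (by omega) _ (isString_lstrip_extend h.two_le hf (by decide) he) fun i hi hik => ?_
        by_cases hik' : i + 1 = k
        · have : i = k - 1 := by omega
          rw [this, mainString_last h.two_le, lstrip, if_neg (by omega), extend,
            if_neg (by omega), if_pos (by omega)]
        · have := hft (i + 1) (by omega) (by omega)
          simp only [lstrip, extend, this, mainString]
          split_ifs <;> first | rfl | contradiction | omega
      exact h.eq_zero_of_extend_X j hf (by rw [hl]; decide)
        (leftTerm_eq_zero _ _ fun _ h2 _ => hz _ h2) (leftTerm_eq_zero _ _ fun _ h2 _ => hz _ h2)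

/-- If the strings `X Z ⋯ Z Y` have coefficient zero, then so do all strings of length `k`. -/
theorem eq_zero_of_mainString (h : IsLocalStationary w J₁ J₂ k c)
    (hm : ∀ j, c (place j (mainString k)) = 0) (j : ZMod N) {f : ℕ → PauliSymbol}
    (hf : IsString k f) : c (place j f) = 0 := by
  have hk2 := h.two_le
  have hlast (f : ℕ → PauliSymbol) (b e e' : PauliSymbol) :
      lstrip (extend f k b e') e (k - 1) = e' := by
    rw [lstrip, if_neg (by omega), extend, if_neg (by omega), if_pos (by omega)]
  have hnX {j : ZMod N} {f : ℕ → PauliSymbol} (hf : IsString k f) (hl : f (k - 1) ≠ X) :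
      c (place j f) = 0 := by
    have hz (e : PauliSymbol) (he : extend f k X Y 1 ≠ e) :
        c (place (j + 1) (lstrip (extend f k X Y) e)) = 0 := by
      refine h.eq_zero_of_agree hm (t := k - 1) (by omega) _
        (isString_lstrip_extend h.two_le hf (by decide) he) fun i hi hik => ?_
      rw [show i = k - 1 by omega, hlast, mainString_last h.two_le]
    exact h.eq_zero_of_extend_X j hf hl
      (leftTerm_eq_zero _ _ fun _ h2 _ => hz _ h2) (leftTerm_eq_zero _ _ fun _ h2 _ => hz _ h2)
  by_cases hl : f (k - 1) = X
  · have hz (e : PauliSymbol) (he : extend f k w Z 1 ≠ e) :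
        c (place (j + 1) (lstrip (extend f k w Z) e)) = 0 :=
      hnX (isString_lstrip_extend h.two_le hf (by decide) he) (by rw [hlast]; decide)
    exact h.eq_zero_of_extend_symbol j hf (hl ▸ h.symbol_ne_X.symm)
      (leftTerm_eq_zero _ _ fun _ h2 _ => hz _ h2) (leftTerm_eq_zero _ _ fun _ h2 _ => hz _ h2)
  · exact hnX hf hl

end IsLocalStationary

end Strings

/-! ### Equations of strings with one interior identity. -/

section Chains

variable {N : ℕ} [NeZero N] {w : PauliSymbol} {J₁ J₂ : ℝ} {k : ℕ} {c : Config N → ℝ}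

/-- The contribution of both bond operators at the positions `i`, `i + 1`. -/
def bondTerms (w : PauliSymbol) (J₁ J₂ : ℝ) (c : Config N → ℝ) (j : ZMod N) (g : ℕ → PauliSymbol)
    (i : ℕ) : ℝ :=
  bondTerm c J₁ X Y (place j g) (j + (i : ZMod N)) +
    bondTerm c J₂ w Z (place j g) (j + (i : ZMod N))

/-- The contribution of the string without its first symbol. -/
def leftTerms (w : PauliSymbol) (J₁ J₂ : ℝ) (c : Config N → ℝ) (j : ZMod N)
    (g : ℕ → PauliSymbol) : ℝ :=
  leftTerm c J₁ X Y j g + leftTerm c J₂ w Z j g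

theorem isString_mulBond {f : ℕ → PauliSymbol} (hf : IsString k f) {u e : PauliSymbol} {i : ℕ}
    (hi : i + 1 < k) (h0 : i = 0 → f 0 ≠ u) (hl : i + 2 = k → f (k - 1) ≠ e) :
    IsString k (mulBond f u e i) := by
  refine ⟨?_, ?_, fun m hm => ?_⟩
  · rw [mulBond]
    split_ifs with h1 h2
    · exact mul_ne_I (h0 h1.symm)
    · contradiction
    · exact hf.first
  · rw [mulBond, if_neg (by omega)]
    split_ifs with h2
    · exact mul_ne_I (hl (by omega))
    · exact hf.last
  · rw [mulBond, if_neg (by omega), if_neg (by omega), hf.outside _ hm]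

namespace IsLocalStationary

theorem inside (h : IsLocalStationary w J₁ J₂ k c) (j : ZMod N) {g : ℕ → PauliSymbol}
    (hg : IsString k g) : ∑ i ∈ Finset.range (k - 1), bondTerms w J₁ J₂ c j g i = 0 :=
  h.stationary.inside (by decide) (by decide) h.symbol_ne_I (by decide) h.two_le h.two_mul_le
    h.arc j hg.outside hg.first hg.last

/-- Bond operators that preserve an identity in the interior and the end points of a string do not
contribute to its coefficient. -/
theorem bondTerm_eq_zero (h : IsLocalStationary w J₁ J₂ k c) (J : ℝ) {u e : PauliSymbol}
    (j : ZMod N) {g : ℕ → PauliSymbol} (hg : IsString k g) {d : ℕ} (hd1 : 1 ≤ d)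
    (hd : d + 2 ≤ k) (hgd : g d = I) {i : ℕ} (hi : i + 1 < k) (hid : i ≠ d) (hid' : i + 1 ≠ d)
    (h0 : i = 0 → g 0 ≠ u) (hl : i + 2 = k → g (k - 1) ≠ e) :
    bondTerm c J u e (place j g) (j + (i : ZMod N)) = 0 := by
  have hk := h.two_mul_le
  rw [bondTerm_place _ _ _ _ _ _ (by omega), h.eq_zero_of_interior hd1 hd j
    (isString_mulBond hg hi h0 hl), mul_zero]
  rw [mulBond, if_neg (by omega), if_neg (by omega), hgd]

theorem bondTerms_zero (h : IsLocalStationary w J₁ J₂ k c) (j : ZMod N) {g : ℕ → PauliSymbol}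
    (hg : IsString k g) {d : ℕ} (hd1 : 2 ≤ d) (hd : d + 2 ≤ k) (hgd : g d = I) :
    bondTerms w J₁ J₂ c j g 0 = leftTerms w J₁ J₂ c j g := by
  have hk := h.two_mul_le
  have h1 (J : ℝ) (u e : PauliSymbol) :
      bondTerm c J u e (place j g) (j + ((0 : ℕ) : ZMod N)) = leftTerm c J u e j g := by
    by_cases h0 : g 0 = u
    · exact bondTerm_eq_leftTerm (by omega) c J u e j g (hg.outside _ (by omega)) h0
    · rw [leftTerm_of_ne _ _ h0]
      exact h.bondTerm_eq_zero J j hg (by omega) hd hgd (by omega) (by omega) (by omega)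
        (fun _ => h0) (by omega)
  rw [bondTerms, leftTerms, h1, h1]

theorem bondTerms_last (h : IsLocalStationary w J₁ J₂ k c) (j : ZMod N) {g : ℕ → PauliSymbol}
    (hg : IsString k g) {d : ℕ} (hd1 : 1 ≤ d) (hd : d + 3 ≤ k) (hgd : g d = I)
    (hl : g (k - 1) = Y) (hl' : g (k - 2) = Z) :
    bondTerms w J₁ J₂ c j g (k - 2) = -(J₁ * c (place j (rstrip g (k - 1) X))) := by
  have hk := h.two_mul_le
  have hX := bondTerm_eq_rightTerm c J₁ X Y j (k - 1) (by omega) (by omega) g hl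
  have hw : bondTerm c J₂ w Z (place j g) (j + ((k - 2 : ℕ) : ZMod N)) = 0 :=
    h.bondTerm_eq_zero J₂ j hg hd1 (by omega) hgd (by omega) (by omega) (by omega) (by omega)
      fun _ => by rw [hl]; decide
  rw [bondTerms, hw, show k - 2 = k - 1 - 1 by omega, hX, rightTerm, if_pos hl,
    show k - 1 - 1 = k - 2 by omega, hl', show weight (Z * X) I X Y = -1 from rfl]
  push_cast
  ring

/-- A bond away from the identity and from both ends keeps the length and the interior identity, so
it contributes nothing. The finset `s` is left free because some of the four positions may coincide.
-/
theorem sum_four (h : IsLocalStationary w J₁ J₂ k c) (j : ZMod N) {g : ℕ → PauliSymbol}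
    (hg : IsString k g) {d : ℕ} (hd1 : 1 ≤ d) (hd : d + 2 ≤ k) (hgd : g d = I) (s : Finset ℕ)
    (hs : s ⊆ Finset.range (k - 1)) (hs' : ∀ i ∈ ({0, d - 1, d, k - 2} : Finset ℕ), i ∈ s) :
    ∑ i ∈ s, bondTerms w J₁ J₂ c j g i = 0 := by
  rw [← h.inside j hg]
  refine Finset.sum_subset hs fun i hi his => ?_
  rw [Finset.mem_range] at hi
  have hne (m : ℕ) (hm : m ∈ ({0, d - 1, d, k - 2} : Finset ℕ)) : i ≠ m := by
    rintro rfl; exact his (hs' _ hm)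
  have h1 := hne 0 (by simp)
  have h2 := hne (d - 1) (by simp)
  have h3 := hne d (by simp)
  have h4 := hne (k - 2) (by simp)
  rw [bondTerms, h.bondTerm_eq_zero J₁ j hg hd1 hd hgd (by omega) h3 (by omega) (by omega)
    (by omega), h.bondTerm_eq_zero J₂ j hg hd1 hd hgd (by omega) h3 (by omega) (by omega)
    (by omega), add_zero]

/-- Bond operators acting on an identity in the interior and on its right neighbour do not
contribute if the part of the string before the identity forces the coefficient to vanish. -/
theorem bondTerms_at (h : IsLocalStationary w J₁ J₂ k c) (j : ZMod N) {g : ℕ → PauliSymbol}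
    (hg : IsString k g) {d : ℕ} (hd1 : 1 ≤ d) (hd : d + 2 ≤ k) (hgd : g d = I)
    (H : ∀ f, IsString k f → (∀ i < d, f i = g i) → c (place j f) = 0) :
    bondTerms w J₁ J₂ c j g d = 0 := by
  have hk := h.two_mul_le
  have h1 (J : ℝ) (u e : PauliSymbol) : bondTerm c J u e (place j g) (j + (d : ZMod N)) = 0 := by
    rw [bondTerm_place _ _ _ _ _ _ (by omega), hgd]
    by_cases he : g (d + 1) = e
    · rw [weight_of_eq_right he]; simp
    · rw [H _ (isString_mulBond hg (by omega) (by omega) fun h2 => ?_) fun i hi => ?_, mul_zero]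
      · rwa [show k - 1 = d + 1 by omega]
      · rw [mulBond, if_neg (by omega), if_neg (by omega)]
  rw [bondTerms, h1, h1, add_zero]

/-- The coefficients of a string `g` with an identity at the interior position `d ≥ 2`. -/
theorem chain_step (h : IsLocalStationary w J₁ J₂ k c) (j : ZMod N) {g : ℕ → PauliSymbol}
    (hg : IsString k g) {d : ℕ} (hd1 : 2 ≤ d) (hd : d + 3 ≤ k) (hgd : g d = I)
    (hl : g (k - 1) = Y) (hl' : g (k - 2) = Z)
    (H : ∀ f, IsString k f → (∀ i < d, f i = g i) → c (place j f) = 0) :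
    J₁ * c (place j (rstrip g (k - 1) X)) =
      leftTerms w J₁ J₂ c j g + bondTerms w J₁ J₂ c j g (d - 1) := by
  have h1 := h.sum_four j hg (by omega) (by omega) hgd {0, d - 1, d, k - 2}
    (fun i hi => by simp at hi ⊢; omega) (fun i hi => hi)
  rw [Finset.sum_insert (by simp; omega), Finset.sum_insert (by simp; omega),
    Finset.sum_insert (by simp; omega), Finset.sum_singleton,
    h.bondTerms_zero j hg hd1 (by omega) hgd, h.bondTerms_at j hg (by omega) (by omega) hgd H,
    h.bondTerms_last j hg (by omega) hd hgd hl hl'] at h1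
  linarith

/-- Here the last bond is the one at the identity, so no string of length `k - 1` appears on the
right and the chain stops. -/
theorem chain_end (h : IsLocalStationary w J₁ J₂ k c) (j : ZMod N) {g : ℕ → PauliSymbol}
    (hg : IsString k g) {d : ℕ} (hd1 : 2 ≤ d) (hd : d + 2 = k) (hgd : g d = I)
    (H : ∀ f, IsString k f → (∀ i < d, f i = g i) → c (place j f) = 0) :
    leftTerms w J₁ J₂ c j g + bondTerms w J₁ J₂ c j g (d - 1) = 0 := by
  have h1 := h.sum_four j hg (by omega) (by omega) hgd {0, d - 1, d}
    (fun i hi => by simp at hi ⊢; omega) (fun i hi => by simp at hi ⊢; omega)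
  rw [Finset.sum_insert (by simp; omega), Finset.sum_insert (by simp; omega),
    Finset.sum_singleton, h.bondTerms_zero j hg hd1 (by omega) hgd,
    h.bondTerms_at j hg (by omega) (by omega) hgd H] at h1
  linarith

/-- The first symbol cannot be stripped, so no string of length `k - 1` appears on the left and the
chain begins. -/
theorem chain_start (h : IsLocalStationary w J₁ J₂ k c) (hk4 : 4 ≤ k) (j : ZMod N)
    {g : ℕ → PauliSymbol} (hg : IsString k g) (hg1 : g 1 = I) (hl : g (k - 1) = Y)
    (hl' : g (k - 2) = Z) (hX : g 0 ≠ X) (hw : g 0 ≠ w) :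
    J₁ * c (place j (rstrip g (k - 1) X)) = bondTerms w J₁ J₂ c j g 0 := by
  have h1 := h.sum_four j hg le_rfl (by omega) hg1 {0, 1, k - 2}
    (fun i hi => by simp at hi ⊢; omega) (fun i hi => by simp at hi ⊢; omega)
  rw [Finset.sum_insert (by simp; omega), Finset.sum_insert (by simp; omega),
    Finset.sum_singleton, h.bondTerms_at j hg le_rfl (by omega) hg1 fun f hf hfg =>
      h.eq_zero_of_first (by omega) j hf (by rwa [hfg 0 one_pos]) (by rwa [hfg 0 one_pos]),
    h.bondTerms_last j hg le_rfl (by omega) hg1 hl hl'] at h1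
  linarith

theorem chain_start_end (h : IsLocalStationary w J₁ J₂ 3 c) (j : ZMod N)
    {g : ℕ → PauliSymbol} (hg : IsString 3 g) (hg1 : g 1 = I) (hX : g 0 ≠ X) (hw : g 0 ≠ w) :
    bondTerms w J₁ J₂ c j g 0 = 0 := by
  have h1 := h.sum_four j hg le_rfl le_rfl hg1 {0, 1} (fun i hi => by simp at hi ⊢; omega)
    (fun i hi => by simp at hi ⊢; omega)
  rwa [Finset.sum_insert (by simp), Finset.sum_singleton, h.bondTerms_at j hg le_rfl le_rfl hg1
    fun f hf hfg => h.eq_zero_of_first le_rfl j hf (by rwa [hfg 0 one_pos])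
      (by rwa [hfg 0 one_pos]), add_zero] at h1

/-- If the symbol before the identity is `X`, then only the other bond operator contributes. -/
theorem bondTerms_before (h : IsLocalStationary w J₁ J₂ k c) (j : ZMod N) {g : ℕ → PauliSymbol}
    (hg : IsString k g) {d : ℕ} (hd1 : 2 ≤ d) (hd : d + 2 ≤ k) (hgd : g d = I)
    (hX : g (d - 1) = X) :
    bondTerms w J₁ J₂ c j g (d - 1) =
      J₂ * sgn (X * w) w * c (place j (mulBond g w Z (d - 1))) := by
  have hk := h.two_mul_le
  rw [bondTerms, bondTerm_place _ _ _ _ _ _ (by omega), bondTerm_place _ _ _ _ _ _ (by omega),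
    show d - 1 + 1 = d by omega, hgd, hX, h.eq_zero_of_interior (d := d - 1) (by omega) (by omega) j
    (isString_mulBond hg (by omega) (by omega) (by omega)), mul_zero, zero_add]
  · rcases h.symbol with rfl | rfl <;> rfl
  -- The bond `X Y` cancels the `X`, which leaves an identity at the interior position `d - 1`.
  · rw [mulBond, if_pos rfl, hX, mul_self]

end IsLocalStationary

/-- The string `w Y Z ⋯ Z Y` of length `k`. -/
def sideString (w : PauliSymbol) (k : ℕ) : ℕ → PauliSymbol :=
  fun i => if i = 0 then w else if i = 1 then Y else if i + 1 < k then Z else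
    if i + 1 = k then Y else I

/-- The string `A I Z ⋯ Z Y` of length `k`. -/
def startString (A : PauliSymbol) (k : ℕ) : ℕ → PauliSymbol :=
  fun i => if i = 0 then A else if i = 1 then I else if i + 1 < k then Z else
    if i + 1 = k then Y else I

namespace IsLocalStationary

/-- The shift strips `w` and turns the next symbol into `Y * Z = X`, which gives X Z⋯Z Y. -/
theorem sideString_eq (h : IsLocalStationary w J₁ J₂ k c) (hk3 : 3 ≤ k) (j : ZMod N) :
    J₁ * c (place j (sideString w k)) = -(J₂ * c (place 0 (mainString k))) := by
  have hs : IsString k (sideString w k) := by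
    refine ⟨by simpa [sideString] using h.symbol_ne_I, ?_, fun i hi => ?_⟩
    · rw [sideString, if_neg (by omega), if_neg (by omega), if_neg (by omega), if_pos (by omega)]
      decide
    · rw [sideString, if_neg (by omega), if_neg (by omega), if_neg (by omega), if_neg (by omega)]
  have hl : sideString w k (k - 1) = Y := by
    rw [sideString, if_neg (by omega), if_neg (by omega), if_neg (by omega), if_pos (by omega)]
  have h1 := h.extend_X j hs
  have g0 : extend (sideString w k) k X Y 0 = w := by
    rw [extend, if_neg (by omega), if_neg (by omega)]; rfl
  have g1 : extend (sideString w k) k X Y 1 = Y := by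
    rw [extend, if_neg (by omega), if_neg (by omega)]; rfl
  have h3 : lstrip (extend (sideString w k) k X Y) Z = mainString k := by
    funext i
    simp only [lstrip, g1]
    simp only [extend, sideString, mainString]
    split_ifs <;> first | rfl | contradiction | omega
  have h4 : weight I (Y * Z) w Z = -1 := by rcases h.symbol with rfl | rfl <;> rfl
  rw [leftTerm_of_ne _ _ (by rw [g0]; exact h.symbol_ne_X), leftTerm, if_pos g0, g1, h3, hl, h4,
    show sgn Y X = -1 from rfl, h.mainString_const] at h1
  push_cast at h1
  linarith

theorem isString_startString {A : PauliSymbol} (hA : A ≠ I) (hk3 : 3 ≤ k) :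
    IsString k (startString A k) := by
  refine ⟨by simpa [startString] using hA, ?_, fun i hi => ?_⟩
  · rw [startString, if_neg (by omega), if_neg (by omega), if_neg (by omega), if_pos (by omega)]
    decide
  · rw [startString, if_neg (by omega), if_neg (by omega), if_neg (by omega), if_neg (by omega)]

/-- The bond `w Z` produces X Z⋯Z Y and the bond `X Y` produces the side string. By `sideString_eq`
both contribute the same amount, hence the factor 2. -/
theorem bondTerms_startString (h : IsLocalStationary w J₁ J₂ k c) (hk3 : 3 ≤ k) (j : ZMod N) :
    bondTerms w J₁ J₂ c j (startString (X * w) k) 0 =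
      2 * sgn X w * (J₂ * c (place 0 (mainString k))) := by
  have hk := h.two_mul_le
  have h1 : mulBond (startString (X * w) k) X Y 0 = sideString w k := by
    funext i
    simp only [mulBond, startString, sideString, mul_comm' X w]
    split_ifs <;> first | rfl | contradiction | omega | exact mul_mul_self _ _
  have h2 : mulBond (startString (X * w) k) w Z 0 = mainString k := by
    funext i
    simp only [mulBond, startString, mainString]
    split_ifs <;> first | rfl | contradiction | omega | exact mul_mul_self _ _
  have h3 := h.sideString_eq hk3 j
  rw [bondTerms, bondTerm_place _ _ _ _ _ _ (by omega), bondTerm_place _ _ _ _ _ _ (by omega),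
    h1, h2, h.mainString_const]
  rcases h.symbol with rfl | rfl
  · rw [show weight (startString (X * Y) k 0 * X) (startString (X * Y) k (0 + 1) * Y) X Y = -1
      from rfl, show weight (startString (X * Y) k 0 * Y) (startString (X * Y) k (0 + 1) * Z) Y Z = 1
      from rfl, show sgn X Y = 1 from rfl]
    push_cast
    linarith
  · rw [show weight (startString (X * Z) k 0 * X) (startString (X * Z) k (0 + 1) * Y) X Y = 1
      from rfl, show weight (startString (X * Z) k 0 * Z) (startString (X * Z) k (0 + 1) * Z) Z Z = -1
      from rfl, show sgn X Z = -1 from rfl]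
    push_cast
    linarith

/-- The coefficient of the string `(X * w) I Z ⋯ Z Y` of length `k - 1`. -/
theorem startString_eq (h : IsLocalStationary w J₁ J₂ k c) (hk4 : 4 ≤ k) (j : ZMod N) :
    J₁ * c (place j (startString (X * w) (k - 1))) =
      2 * sgn X w * (J₂ * c (place 0 (mainString k))) := by
  have hA : X * w ≠ I := by rcases h.symbol with rfl | rfl <;> decide
  have hr : rstrip (startString (X * w) k) (k - 1) X = startString (X * w) (k - 1) := by
    funext i
    simp only [rstrip, startString]
    split_ifs <;> first | rfl | contradiction | omega
  rw [← h.bondTerms_startString (by omega) j, ← hr]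
  refine h.chain_start hk4 j (isString_startString hA (by omega)) rfl ?_ ?_ ?_ ?_
  · rw [startString, if_neg (by omega), if_neg (by omega), if_neg (by omega), if_pos (by omega)]
  · rw [startString, if_neg (by omega), if_neg (by omega), if_pos (by omega)]
  · rcases h.symbol with rfl | rfl <;> simp [startString] <;> decide
  · rcases h.symbol with rfl | rfl <;> simp [startString] <;> decide

/-- For length 3 the chain consists of a single equation, without strings of length 2. -/
theorem mainString_eq_zero_of_three (h : IsLocalStationary w J₁ J₂ 3 c) (j : ZMod N) :
    c (place j (mainString 3)) = 0 := by
  have hA : X * w ≠ I := by rcases h.symbol with rfl | rfl <;> decide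
  have h1 := h.chain_start_end 0 (isString_startString hA le_rfl) rfl
    (by rcases h.symbol with rfl | rfl <;> simp [startString] <;> decide)
    (by rcases h.symbol with rfl | rfl <;> simp [startString] <;> decide)
  rw [h.bondTerms_startString le_rfl] at h1
  have h2 : (sgn X w : ℝ) ≠ 0 := by
    exact_mod_cast sgn_ne_zero (by decide) h.symbol_ne_I h.symbol_ne_X.symm
  rw [h.mainString_const]
  simpa [h2, h.ne_zero₂] using h1

end IsLocalStationary

end Chains

/-! ### The telescoping chain for w = Y. -/

namespace PauliSymbol

theorem Z_mul_X : Z * X = Y := rfl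

theorem Z_mul_Y : Z * Y = X := rfl

theorem Y_mul_X : Y * X = Z := rfl

end PauliSymbol

section Chains

variable {N : ℕ} [NeZero N] {w : PauliSymbol} {J₁ J₂ : ℝ} {k : ℕ} {c : Config N → ℝ}

/-- The string `X Z^p X I Z ⋯ Z Y` of length `k`. -/
def chainStringY (k p : ℕ) : ℕ → PauliSymbol :=
  fun i => if i = 0 then X else if i ≤ p then Z else if i = p + 1 then X else
    if i = p + 2 then I else if i + 1 < k then Z else if i + 1 = k then Y else I

theorem chainStringY_last {p : ℕ} (hp : p + 4 ≤ k) : chainStringY k p (k - 1) = Y := by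
  rw [chainStringY, if_neg (by omega), if_neg (by omega), if_neg (by omega), if_neg (by omega),
    if_neg (by omega), if_pos (by omega)]

theorem chainStringY_penultimate {p : ℕ} (hp : p + 5 ≤ k) :
    chainStringY k p (k - 2) = Z := by
  rw [chainStringY, if_neg (by omega), if_neg (by omega), if_neg (by omega), if_neg (by omega),
    if_pos (by omega)]

theorem isString_chainStringY {p : ℕ} (hp : p + 4 ≤ k) : IsString k (chainStringY k p) := by
  refine ⟨by simp [chainStringY], ?_, fun i hi => ?_⟩
  · simp only [chainStringY]
    split_ifs <;> first | omega | decide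
  · simp only [chainStringY]
    split_ifs <;> first | omega | rfl

theorem lstrip_chainStringY {p : ℕ} (hp : p + 5 ≤ k) :
    lstrip (chainStringY k (p + 1)) Y = chainStringY (k - 1) p := by
  funext i
  grind [lstrip, chainStringY, Z_mul_Y]

theorem rstrip_chainStringY {p : ℕ} (hp : p + 5 ≤ k) :
    rstrip (chainStringY k p) (k - 1) X = chainStringY (k - 1) p := by
  funext i
  grind [rstrip, chainStringY, Z_mul_X]

namespace IsLocalStationary

/-- Each shift strips `X` and turns the next `Z` into `Z * Y = X`, until the string begins with `X
X`. One more shift makes it begin with `X * Y = Z`, which neither bond can strip when w = Y. -/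
theorem eq_zero_of_prefixY (h : IsLocalStationary Y J₁ J₂ k c) {p : ℕ} (hp : p + 3 ≤ k)
    (j : ZMod N) {f : ℕ → PauliSymbol} (hf : IsString k f) (h0 : f 0 = X)
    (hZ : ∀ i, 1 ≤ i → i ≤ p → f i = Z) (hX : f (p + 1) = X) : c (place j f) = 0 := by
  induction p generalizing j f with
  | zero =>
    refine h.eq_zero_of_shift (by omega) j hf fun f' e hf' he _ _ h1 _ => ?_
    obtain rfl : e = Y := by simpa [h0] using he
    rw [hX] at h1
    exact h.eq_zero_of_first (by omega) _ hf' (by rw [h1]; decide) (by rw [h1]; decide)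
  | succ p ih =>
    refine h.eq_zero_of_shift (by omega) j hf fun f' e hf' he _ _ h1 h2 => ?_
    obtain rfl : e = Y := by simpa [h0] using he
    rw [hZ 1 le_rfl (by omega)] at h1
    refine ih (by omega) _ hf' h1 (fun i hi hip => ?_) ((h2 p (by omega)).trans hX)
    have h3 := h2 (i - 1) (by omega)
    rwa [show i - 1 + 1 = i by omega, show i - 1 + 2 = i + 1 by omega,
      hZ (i + 1) (by omega) (by omega)] at h3

theorem chainStringY_forced (h : IsLocalStationary Y J₁ J₂ k c) {p : ℕ} (hp : p + 4 ≤ k)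
    (j : ZMod N) (f : ℕ → PauliSymbol) (hf : IsString k f)
    (hfg : ∀ i < p + 2, f i = chainStringY k p i) : c (place j f) = 0 := by
  refine h.eq_zero_of_prefixY (p := p) (by omega) j hf (hfg 0 (by omega)) (fun i hi hip => ?_) ?_
  · rw [hfg i (by omega), chainStringY, if_neg (by omega), if_pos hip]
  · rw [hfg _ (by omega), chainStringY, if_neg (by omega), if_neg (by omega), if_pos rfl]

theorem chainStringY_I {p : ℕ} : chainStringY k p (p + 2) = I := by
  simp [chainStringY]

/-- The bond `Y Z` turns `X I` into `Z Z` and so restores X Z⋯Z Y. -/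
theorem bondTerms_chainStringY (h : IsLocalStationary Y J₁ J₂ k c) {p : ℕ} (hp : p + 4 ≤ k)
    (j : ZMod N) :
    bondTerms Y J₁ J₂ c j (chainStringY k p) (p + 2 - 1) =
      -(J₂ * c (place 0 (mainString k))) := by
  have hm : mulBond (chainStringY k p) Y Z (p + 2 - 1) = mainString k := by
    funext i
    simp only [mulBond, chainStringY, mainString]
    split_ifs <;> first | rfl | contradiction | omega
  rw [h.bondTerms_before j (isString_chainStringY hp) (by omega) (by omega) chainStringY_I
    (by simp [chainStringY]), hm, h.mainString_const, show sgn (X * Y) Y = -1 from rfl]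
  push_cast
  ring

/-- The chain string of index `p + 1` without its first symbol is the one of index `p` without its
last symbol, so `chain_step` adds one multiple for each step. The initial 2 comes from
`startString_eq`. -/
theorem leftTerms_chainStringY (h : IsLocalStationary Y J₁ J₂ k c) {p : ℕ} (hp : p + 4 ≤ k)
    (j : ZMod N) :
    leftTerms Y J₁ J₂ c j (chainStringY k p) =
      -((p + 2) * (J₂ * c (place 0 (mainString k)))) := by
  induction p generalizing j with
  | zero =>
    have hs : lstrip (chainStringY k 0) Y = startString (X * Y) (k - 1) := by
      funext i
      simp only [lstrip, chainStringY, startString]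
      split_ifs <;> first | rfl | contradiction | omega
    have h1 := h.startString_eq (by omega) (j + 1)
    have h0 : chainStringY k 0 0 = X := rfl
    rw [leftTerms, leftTerm_of_ne (u := Y) _ _ (by simp [chainStringY]), leftTerm, if_pos h0, hs,
      show weight I (chainStringY k 0 1 * Y) X Y = -1 from rfl]
    rw [show sgn X Y = 1 from rfl] at h1
    push_cast at h1 ⊢
    linarith
  | succ p ih =>
    have hs := lstrip_chainStringY (p := p) (k := k) (by omega)
    have hr := rstrip_chainStringY (p := p) (k := k) (by omega)
    have h1 := h.chain_step (j + 1) (isString_chainStringY (p := p) (by omega)) (d := p + 2)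
      (by omega) (by omega) chainStringY_I
      (chainStringY_last (by omega)) (chainStringY_penultimate (by omega))
      (h.chainStringY_forced (by omega) _)
    rw [ih (by omega), h.bondTerms_chainStringY (by omega), hr] at h1
    have h2 : chainStringY k (p + 1) 1 = Z := by simp [chainStringY]
    have h0 : chainStringY k (p + 1) 0 = X := rfl
    rw [leftTerms, leftTerm_of_ne (u := Y) _ _ (by simp [chainStringY]), leftTerm, if_pos h0, hs,
      h2, show weight I (Z * Y) X Y = 1 from rfl]
    push_cast
    linarith

theorem mainString_eq_zeroY (h : IsLocalStationary Y J₁ J₂ k c) (hk4 : 4 ≤ k) (j : ZMod N) :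
    c (place j (mainString k)) = 0 := by
  obtain ⟨p, rfl⟩ : ∃ p, k = p + 4 := ⟨k - 4, by omega⟩
  have h1 := h.chain_end 0 (isString_chainStringY (p := p) le_rfl) (d := p + 2) (by omega) rfl
    chainStringY_I (h.chainStringY_forced le_rfl _)
  rw [h.leftTerms_chainStringY le_rfl, h.bondTerms_chainStringY le_rfl] at h1
  -- The factor is `k - 1`: `p + 2` from the left terms and 1 from the bond at the identity.
  have h2 : ((p : ℝ) + 3) * (J₂ * c (place 0 (mainString (p + 4)))) = 0 := by linarith
  have h3 : (p : ℝ) + 3 ≠ 0 := by positivity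
  rw [h.mainString_const]
  simpa [h.ne_zero₂, h3] using h2

end IsLocalStationary

/-! ### The telescoping chain for w = Z. -/

/-- The string `Z X I Z ⋯ Z Y` of length `k`. -/
def firstChainStringZ (k : ℕ) : ℕ → PauliSymbol :=
  fun i => if i = 0 then Z else if i = 1 then X else if i = 2 then I else
    if i + 1 < k then Z else if i + 1 = k then Y else I

/-- The string `X Z^p X X I Z ⋯ Z Y` of length `k`. -/
def chainStringZ (k p : ℕ) : ℕ → PauliSymbol :=
  fun i => if i = 0 then X else if i ≤ p then Z else if i = p + 1 then X else
    if i = p + 2 then X else if i = p + 3 then I else if i + 1 < k then Z else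
      if i + 1 = k then Y else I

/-- The string `X Z^p X Y Z ⋯ Z Y` of length `k`. -/
def sideStringZ (k p : ℕ) : ℕ → PauliSymbol :=
  fun i => if i = 0 then X else if i ≤ p then Z else if i = p + 1 then X else
    if i = p + 2 then Y else if i + 1 < k then Z else if i + 1 = k then Y else I

theorem isString_firstChainStringZ (hk : 4 ≤ k) : IsString k (firstChainStringZ k) := by
  refine ⟨by simp [firstChainStringZ], ?_, fun i hi => ?_⟩
  · simp only [firstChainStringZ]
    split_ifs <;> first | omega | decide
  · simp only [firstChainStringZ]
    split_ifs <;> first | omega | rfl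

theorem chainStringZ_last {p : ℕ} (hp : p + 5 ≤ k) : chainStringZ k p (k - 1) = Y := by
  rw [chainStringZ, if_neg (by omega), if_neg (by omega), if_neg (by omega), if_neg (by omega),
    if_neg (by omega), if_neg (by omega), if_pos (by omega)]

theorem chainStringZ_penultimate {p : ℕ} (hp : p + 6 ≤ k) :
    chainStringZ k p (k - 2) = Z := by
  rw [chainStringZ, if_neg (by omega), if_neg (by omega), if_neg (by omega), if_neg (by omega),
    if_neg (by omega), if_pos (by omega)]

theorem isString_chainStringZ {p : ℕ} (hp : p + 5 ≤ k) : IsString k (chainStringZ k p) := by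
  refine ⟨by simp [chainStringZ], ?_, fun i hi => ?_⟩
  · simp only [chainStringZ]
    split_ifs <;> first | omega | decide
  · simp only [chainStringZ]
    split_ifs <;> first | omega | rfl

theorem isString_sideStringZ {p : ℕ} (hp : p + 4 ≤ k) : IsString k (sideStringZ k p) := by
  refine ⟨by simp [sideStringZ], ?_, fun i hi => ?_⟩
  · simp only [sideStringZ]
    split_ifs <;> first | omega | decide
  · simp only [sideStringZ]
    split_ifs <;> first | omega | rfl

theorem lstrip_chainStringZ {p : ℕ} (hp : p + 6 ≤ k) :
    lstrip (chainStringZ k (p + 1)) Y = chainStringZ (k - 1) p := by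
  funext i
  grind (splits := 20) [lstrip, chainStringZ, Z_mul_Y]

theorem rstrip_chainStringZ {p : ℕ} (hp : p + 6 ≤ k) :
    rstrip (chainStringZ k p) (k - 1) X = chainStringZ (k - 1) p := by
  funext i
  grind (splits := 20) [rstrip, chainStringZ, Z_mul_X]

theorem lstrip_extend_sideStringZ {p : ℕ} (hp : p + 5 ≤ k) :
    lstrip (extend (sideStringZ k (p + 1)) k X Y) Y = sideStringZ k p := by
  funext i
  grind (splits := 20) [lstrip, extend, sideStringZ, Z_mul_Y, Y_mul_X]

namespace IsLocalStationary

theorem eq_zero_of_prefix_ZX (h : IsLocalStationary Z J₁ J₂ k c) (hk3 : 3 ≤ k)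
    (j : ZMod N) {f : ℕ → PauliSymbol} (hf : IsString k f) (h0 : f 0 = Z) (hX : f 1 = X) :
    c (place j f) = 0 := by
  refine h.eq_zero_of_shift (by omega) j hf fun f' e hf' he _ _ h1 _ => ?_
  obtain rfl : e = Z := by simpa [h0] using he
  rw [hX] at h1
  exact h.eq_zero_of_first (by omega) _ hf' (by rw [h1]; decide) (by rw [h1]; decide)

/-- As for w = Y, but now the bond `Z Z` can strip the `Z` obtained from `X X`. The additional `X`
makes the next shift begin with `X * Z = Y`, which cannot be stripped. -/
theorem eq_zero_of_prefixZ (h : IsLocalStationary Z J₁ J₂ k c) {p : ℕ} (hp : p + 4 ≤ k)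
    (j : ZMod N) {f : ℕ → PauliSymbol} (hf : IsString k f) (h0 : f 0 = X)
    (hZ : ∀ i, 1 ≤ i → i ≤ p → f i = Z) (hX : f (p + 1) = X) (hX' : f (p + 2) = X) :
    c (place j f) = 0 := by
  induction p generalizing j f with
  | zero =>
    refine h.eq_zero_of_shift (by omega) j hf fun f' e hf' he _ _ h1 h2 => ?_
    obtain rfl : e = Y := by simpa [h0] using he
    rw [hX] at h1
    exact h.eq_zero_of_prefix_ZX (by omega) _ hf' h1 ((h2 0 (by omega)).trans hX')
  | succ p ih =>
    refine h.eq_zero_of_shift (by omega) j hf fun f' e hf' he _ _ h1 h2 => ?_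
    obtain rfl : e = Y := by simpa [h0] using he
    rw [hZ 1 le_rfl (by omega)] at h1
    refine ih (by omega) _ hf' h1 (fun i hi hip => ?_) ((h2 p (by omega)).trans hX)
      ((h2 (p + 1) (by omega)).trans hX')
    have h3 := h2 (i - 1) (by omega)
    rwa [show i - 1 + 1 = i by omega, show i - 1 + 2 = i + 1 by omega,
      hZ (i + 1) (by omega) (by omega)] at h3

theorem chainStringZ_forced (h : IsLocalStationary Z J₁ J₂ k c) {p : ℕ} (hp : p + 5 ≤ k)
    (j : ZMod N) (f : ℕ → PauliSymbol) (hf : IsString k f)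
    (hfg : ∀ i < p + 3, f i = chainStringZ k p i) : c (place j f) = 0 := by
  refine h.eq_zero_of_prefixZ (p := p) (by omega) j hf (hfg 0 (by omega)) (fun i hi hip => ?_) ?_ ?_
  · rw [hfg i (by omega), chainStringZ, if_neg (by omega), if_pos hip]
  · rw [hfg _ (by omega), chainStringZ, if_neg (by omega), if_neg (by omega), if_pos rfl]
  · rw [hfg _ (by omega), chainStringZ, if_neg (by omega), if_neg (by omega), if_neg (by omega),
      if_pos rfl]

theorem chainStringZ_I {p : ℕ} : chainStringZ k p (p + 3) = I := by
  simp [chainStringZ]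

/-- Shifts strip the symbols `Z` one by one without changing the coefficient; the last shift reaches
the side string and reverses the sign. -/
theorem sideStringZ_eq (h : IsLocalStationary Z J₁ J₂ k c) {p : ℕ} (hp : p + 4 ≤ k)
    (j : ZMod N) :
    J₁ * c (place j (sideStringZ k p)) = J₂ * c (place 0 (mainString k)) := by
  have hl {p : ℕ} (hp : p + 4 ≤ k) : sideStringZ k p (k - 1) = Y := by
    simp only [sideStringZ]; split_ifs <;> first | rfl | omega
  induction p generalizing j with
  | zero =>
    have h1 := h.extend_X j (isString_sideStringZ hp)
    have g0 : extend (sideStringZ k 0) k X Y 0 = X := by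
      rw [extend, if_neg (by omega), if_neg (by omega)]; rfl
    have g1 : extend (sideStringZ k 0) k X Y 1 = X := by
      rw [extend, if_neg (by omega), if_neg (by omega)]; rfl
    have hs : lstrip (extend (sideStringZ k 0) k X Y) Y = sideString Z k := by
      funext i
      simp only [lstrip, g1]
      simp only [extend, sideStringZ, sideString]
      split_ifs <;> first | rfl | contradiction | omega
    have h2 := h.sideString_eq (by omega) (j + 1)
    rw [leftTerm_of_ne (u := Z) _ _ (by rw [g0]; decide), leftTerm, if_pos g0, g1, hs, hl hp,
      show weight I (X * Y) X Y = -1 from rfl, show sgn Y X = -1 from rfl] at h1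
    push_cast at h1
    linarith
  | succ p ih =>
    have h1 := h.extend_X j (isString_sideStringZ hp)
    have g0 : extend (sideStringZ k (p + 1)) k X Y 0 = X := by
      rw [extend, if_neg (by omega), if_neg (by omega)]; rfl
    have g1 : extend (sideStringZ k (p + 1)) k X Y 1 = Z := by
      rw [extend, if_neg (by omega), if_neg (by omega)]; simp [sideStringZ]
    have hs := lstrip_extend_sideStringZ (p := p) (k := k) (by omega)
    have h2 := ih (by omega) (j + 1)
    rw [leftTerm_of_ne (u := Z) _ _ (by rw [g0]; decide), leftTerm, if_pos g0, g1, hs, hl hp,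
      show weight I (Z * Y) X Y = 1 from rfl, show sgn Y X = -1 from rfl] at h1
    push_cast at h1
    linarith

/-- Two of the three multiples come from the start string, one from the side string that the bond `Z
Z` creates at the identity. Both coefficients carry J₂ / J₁, hence the factor `J₁` on the left. -/
theorem leftTerms_add_bondTerms_firstChainStringZ (h : IsLocalStationary Z J₁ J₂ k c)
    (hk4 : 4 ≤ k) (j : ZMod N) :
    J₁ * (leftTerms Z J₁ J₂ c j (firstChainStringZ k) +
      bondTerms Z J₁ J₂ c j (firstChainStringZ k) (2 - 1)) =
      -(3 * (J₂ * (J₂ * c (place 0 (mainString k))))) := by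
  have hs : lstrip (firstChainStringZ k) Z = startString (X * Z) (k - 1) := by
    funext i
    simp only [lstrip, firstChainStringZ, startString]
    split_ifs <;> first | rfl | contradiction | omega
  have hm : mulBond (firstChainStringZ k) Z Z (2 - 1) = sideString Z k := by
    funext i
    simp only [mulBond, firstChainStringZ, sideString]
    split_ifs <;> first | rfl | contradiction | omega
  have h1 := h.startString_eq (by omega) (j + 1)
  have h2 := h.sideString_eq (by omega) j
  have h0 : firstChainStringZ k 0 = Z := rfl
  rw [h.bondTerms_before j (isString_firstChainStringZ hk4) le_rfl (by omega) rfl rfl, hm,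
    leftTerms, leftTerm_of_ne (u := X) _ _ (by simp [firstChainStringZ]), leftTerm, if_pos h0, hs,
    show weight I (firstChainStringZ k 1 * Z) Z Z = 1 from rfl, show sgn (X * Z) Z = 1 from rfl]
  rw [show sgn X Z = -1 from rfl] at h1
  push_cast at h1 ⊢
  linear_combination J₂ * h1 + J₂ * h2

theorem firstChainStringZ_forced (h : IsLocalStationary Z J₁ J₂ k c) (hk4 : 4 ≤ k)
    (j : ZMod N) (f : ℕ → PauliSymbol) (hf : IsString k f)
    (hfg : ∀ i < 2, f i = firstChainStringZ k i) : c (place j f) = 0 :=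
  h.eq_zero_of_prefix_ZX (by omega) j hf (hfg 0 (by omega)) (hfg 1 (by omega))

theorem bondTerms_chainStringZ (h : IsLocalStationary Z J₁ J₂ k c) {p : ℕ} (hp : p + 5 ≤ k)
    (j : ZMod N) :
    J₁ * bondTerms Z J₁ J₂ c j (chainStringZ k p) (p + 3 - 1) =
      J₂ * (J₂ * c (place 0 (mainString k))) := by
  have hm : mulBond (chainStringZ k p) Z Z (p + 3 - 1) = sideStringZ k p := by
    funext i
    simp only [mulBond, chainStringZ, sideStringZ]
    split_ifs <;> first | rfl | contradiction | omega
  have h1 := h.sideStringZ_eq (p := p) (by omega) j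
  rw [h.bondTerms_before j (isString_chainStringZ hp) (by omega) (by omega) chainStringZ_I
    (by simp [chainStringZ]), hm, show sgn (X * Z) Z = 1 from rfl]
  push_cast
  linear_combination J₂ * h1

/-- The same telescoping as for w = Y, started by the string Z X I Z⋯Z Y, which contributes the 3.
-/
theorem leftTerms_chainStringZ (h : IsLocalStationary Z J₁ J₂ k c) {p : ℕ} (hp : p + 5 ≤ k)
    (j : ZMod N) :
    J₁ * leftTerms Z J₁ J₂ c j (chainStringZ k p) =
      (p + 3) * (J₂ * (J₂ * c (place 0 (mainString k)))) := by
  induction p generalizing j with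
  | zero =>
    have hs : lstrip (chainStringZ k 0) Y = rstrip (firstChainStringZ k) (k - 1) X := by
      funext i
      simp only [lstrip, rstrip, chainStringZ, firstChainStringZ]
      split_ifs <;> first | rfl | contradiction | omega
    have h1 := h.chain_step (j + 1) (isString_firstChainStringZ (by omega)) (d := 2)
      le_rfl (by omega) rfl
      (by simp only [firstChainStringZ]; split_ifs <;> first | rfl | omega)
      (by simp only [firstChainStringZ]; split_ifs <;> first | rfl | omega)
      (h.firstChainStringZ_forced (by omega) _)
    have h2 := h.leftTerms_add_bondTerms_firstChainStringZ (by omega) (j + 1)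
    have h0 : chainStringZ k 0 0 = X := rfl
    rw [leftTerms, leftTerm_of_ne (u := Z) _ _ (by simp [chainStringZ]), leftTerm, if_pos h0, hs,
      show weight I (chainStringZ k 0 1 * Y) X Y = -1 from rfl]
    push_cast
    linear_combination -J₁ * h1 - h2
  | succ p ih =>
    have hs := lstrip_chainStringZ (p := p) (k := k) (by omega)
    have hr := rstrip_chainStringZ (p := p) (k := k) (by omega)
    have h1 := h.chain_step (j + 1) (isString_chainStringZ (p := p) (by omega)) (d := p + 3)
      (by omega) (by omega) chainStringZ_I
      (chainStringZ_last (by omega)) (chainStringZ_penultimate (by omega))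
      (h.chainStringZ_forced (by omega) _)
    rw [hr] at h1
    have h2 := ih (by omega) (j + 1)
    have h3 := h.bondTerms_chainStringZ (p := p) (by omega) (j + 1)
    have h4 : chainStringZ k (p + 1) 1 = Z := by simp [chainStringZ]
    have h0 : chainStringZ k (p + 1) 0 = X := rfl
    rw [leftTerms, leftTerm_of_ne (u := Z) _ _ (by simp [chainStringZ]), leftTerm, if_pos h0, hs,
      h4, show weight I (Z * Y) X Y = 1 from rfl]
    push_cast
    linear_combination J₁ * h1 + h2 + h3

theorem mainString_eq_zeroZ (h : IsLocalStationary Z J₁ J₂ k c) (hk4 : 4 ≤ k) (j : ZMod N) :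
    c (place j (mainString k)) = 0 := by
  rw [h.mainString_const]
  rcases Nat.eq_or_lt_of_le hk4 with rfl | hk5
  · have h1 := h.chain_end 0 (isString_firstChainStringZ le_rfl) (d := 2) le_rfl rfl rfl
      (h.firstChainStringZ_forced le_rfl _)
    have h2 := h.leftTerms_add_bondTerms_firstChainStringZ le_rfl 0
    rw [h1] at h2
    simpa [h.ne_zero₂] using h2
  · obtain ⟨p, rfl⟩ : ∃ p, k = p + 5 := ⟨k - 5, by omega⟩
    have h1 := h.chain_end 0 (isString_chainStringZ (p := p) le_rfl) (d := p + 3) (by omega) rfl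
      chainStringZ_I (h.chainStringZ_forced le_rfl _)
    -- Again the factor is `k - 1`.
    have h2 : ((p : ℝ) + 4) * (J₂ * (J₂ * c (place 0 (mainString (p + 5))))) = 0 := by
      linear_combination J₁ * h1 - h.leftTerms_chainStringZ (p := p) le_rfl 0 -
        h.bondTerms_chainStringZ (p := p) le_rfl 0
    have h3 : (p : ℝ) + 4 ≠ 0 := by positivity
    simpa [h.ne_zero₂, h3] using h2

theorem mainString_eq_zero (h : IsLocalStationary w J₁ J₂ k c) (hk3 : 3 ≤ k) (j : ZMod N) :
    c (place j (mainString k)) = 0 := by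
  rcases Nat.eq_or_lt_of_le hk3 with rfl | hk4
  · exact h.mainString_eq_zero_of_three j
  · rcases h.symbol with rfl | rfl
    · exact h.mainString_eq_zeroY hk4 j
    · exact h.mainString_eq_zeroZ hk4 j

end IsLocalStationary

end Chains

/-! ### Descent of the support to single sites. -/

section Vanishing

variable {N : ℕ}

theorem IsArcSupported.eq_zero_of_ne {c : Config N → ℝ} (hc : IsArcSupported 1 c) {P : Config N} {s t : ZMod N}
    (hst : s ≠ t) (hs : P s ≠ I) (ht : P t ≠ I) : c P = 0 := by
  by_contra h
  obtain ⟨a, ha⟩ := hc P h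
  have h1 (r : ZMod N) (hr : P r ≠ I) : r = a := by
    have := ha r hr
    rw [Nat.lt_one_iff, ZMod.val_eq_zero, sub_eq_zero] at this
    exact this
  exact hst ((h1 s hs).trans (h1 t ht).symm)

theorem IsArcSupported.place_eq_zero_of_ne {c : Config N → ℝ} (hc : IsArcSupported 1 c) (j : ZMod N)
    {f : ℕ → PauliSymbol} {a b : ℕ} (ha : a < N) (hb : b < N) (hab : a ≠ b) (hfa : f a ≠ I)
    (hfb : f b ≠ I) : c (place j f) = 0 :=
  hc.eq_zero_of_ne (mt (add_natCast_inj j ha hb).1 hab) (by rwa [place_add _ _ ha])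
    (by rwa [place_add _ _ hb])

variable [NeZero N] {w : PauliSymbol} {J₁ J₂ : ℝ} {k : ℕ} {c : Config N → ℝ}

/-- If the strings of length `k` have coefficient zero, then arcs of `k - 1` sites suffice. -/
theorem IsArcSupported.pred (hk1 : 1 ≤ k) (hc : IsArcSupported k c)
    (H : ∀ j f, IsString k f → c (place j f) = 0) : IsArcSupported (k - 1) c := by
  intro P hP
  obtain ⟨a, ha⟩ := hc P hP
  have ha' (i : ℕ) (hi : i < N) (hPi : P (a + (i : ZMod N)) ≠ I) : i < k := by
    have := ha _ hPi
    rwa [add_sub_cancel_left, ZMod.val_natCast_of_lt hi] at this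
  by_cases h0 : P a = I
  · refine ⟨a + 1, fun s hs => ?_⟩
    obtain ⟨i, hi, rfl⟩ := exists_eq_add a s
    have h1 := ha' i hi hs
    have h2 : i ≠ 0 := by rintro rfl; simp [h0] at hs
    obtain ⟨i, rfl⟩ : ∃ m, i = m + 1 := ⟨i - 1, by omega⟩
    rw [show a + ((i + 1 : ℕ) : ZMod N) - (a + 1) = (i : ZMod N) by push_cast; ring,
      ZMod.val_natCast_of_lt (by omega)]
    omega
  by_cases hl : P (a + ((k - 1 : ℕ) : ZMod N)) = I
  · refine ⟨a, fun s hs => ?_⟩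
    obtain ⟨i, hi, rfl⟩ := exists_eq_add a s
    have h1 := ha' i hi hs
    have h2 : i ≠ k - 1 := by rintro rfl; exact hs hl
    rw [add_sub_cancel_left, ZMod.val_natCast_of_lt hi]
    omega
  let f : ℕ → PauliSymbol := fun i => if i < k then P (a + (i : ZMod N)) else I
  have hf : place a f = P := by
    funext s
    obtain ⟨i, hi, rfl⟩ := exists_eq_add a s
    rw [place_add _ _ hi]
    by_cases hik : i < k
    · simp [f, hik]
    · simp only [f, hik, if_false]
      by_contra hne
      exact hik (ha' i hi (Ne.symm hne))
  refine absurd ?_ hP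
  rw [← hf]
  refine H a f ⟨?_, ?_, fun i hi => if_neg (by omega)⟩
  · simpa [f, Nat.lt_of_succ_le hk1] using h0
  · simpa only [f, if_pos (by omega : k - 1 < k)] using hl

/-- The string `A B`. -/
def pairString (A B : PauliSymbol) : ℕ → PauliSymbol :=
  fun i => if i = 0 then A else if i = 1 then B else I

/-- Every other bond leaves symbols on at least two sites. For the bond ending at `j` this uses `N ≥
3`, so that its first site differs from the site of `B`. -/
theorem IsStationary.pair {u₁ e₁ u₂ e₂ : PauliSymbol} (hs : IsStationary c J₁ u₁ e₁ J₂ u₂ e₂)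
    (hu₁ : u₁ ≠ I) (he₁ : e₁ ≠ I) (hu₂ : u₂ ≠ I) (he₂ : e₂ ≠ I) (hN : 3 ≤ N)
    (hc : IsArcSupported 1 c) (j : ZMod N) {A B : PauliSymbol} (hA : A ≠ I) (hB : B ≠ I) :
    J₁ * weight (A * u₁) (B * e₁) u₁ e₁ * c (place j (pairString (A * u₁) (B * e₁))) +
      J₂ * weight (A * u₂) (B * e₂) u₂ e₂ * c (place j (pairString (A * u₂) (B * e₂))) = 0 := by
  have h0 (J : ℝ) (u e : PauliSymbol) :
      bondTerm c J u e (place j (pairString A B)) (j + ((0 : ℕ) : ZMod N)) =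
        J * weight (A * u) (B * e) u e * c (place j (pairString (A * u) (B * e))) := by
    have h1 : mulBond (pairString A B) u e 0 = pairString (A * u) (B * e) := by
      funext i
      simp only [mulBond, pairString]
      split_ifs <;> rfl
    rw [bondTerm_place _ _ _ _ _ _ (by omega), h1]
    rfl
  have h1 (J : ℝ) (u e : PauliSymbol) (hu : u ≠ I) (he : e ≠ I) (i : ℕ) (hi : i < N)
      (hi0 : i ≠ 0) : bondTerm c J u e (place j (pairString A B)) (j + (i : ZMod N)) = 0 := by
    by_cases hw : i + 1 = N
    · rw [show i = N - 1 by omega, bondTerm_place_wrap]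
      rw [hc.eq_zero_of_ne (s := j + ((N - 1 : ℕ) : ZMod N)) (t := j + ((1 : ℕ) : ZMod N)), mul_zero]
      · rw [Ne, add_natCast_inj j (by omega) (by omega)]
        omega
      · rw [place_mul_bondConfig_wrap _ _ _ _ (by omega), if_pos (by omega), pairString,
          if_neg (by omega), if_neg (by omega), I_mul]
        exact hu
      · rw [place_mul_bondConfig_wrap _ _ _ _ (by omega), if_neg (by omega), if_neg (by omega),
          mul_I]
        exact hB
    rw [bondTerm_place _ _ _ _ _ _ (by omega)]
    by_cases hi1 : i = 1
    · subst hi1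
      rw [hc.place_eq_zero_of_ne j (a := 0) (b := 2) (by omega) (by omega) (by omega) hA, mul_zero]
      change I * e ≠ I
      rwa [I_mul]
    · rw [hc.place_eq_zero_of_ne j (a := 0) (b := 1) (by omega) (by omega) (by omega), mul_zero]
      · rw [mulBond, if_neg (by omega), if_neg (by omega)]; exact hA
      · rw [mulBond, if_neg (by omega), if_neg (by omega)]; exact hB
  have h := hs (place j (pairString A B))
  rw [sum_eq_sum_range j, Finset.sum_eq_single 0] at h
  · rwa [h0, h0] at h
  · intro i hi hi0
    have hi' := Finset.mem_range.1 hi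
    rw [h1 _ _ _ hu₁ he₁ i hi' hi0, h1 _ _ _ hu₂ he₂ i hi' hi0, add_zero]
  · intro h; simp at h; omega

/-- In each chosen equation one bond leaves the single symbol `D`. The other leaves two symbols or
the single symbol `X`, which is why `X` is treated first. -/
theorem IsStationary.single_eq_zero (hs : IsStationary c J₁ X Y J₂ w Z) (hw : w = Y ∨ w = Z)
    (hJ₁ : J₁ ≠ 0) (hJ₂ : J₂ ≠ 0) (hN : 3 ≤ N) (hc : IsArcSupported 1 c) (j : ZMod N)
    {D : PauliSymbol} (hD : D ≠ I) : c (place j (pairString D I)) = 0 := by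
  have hwI : w ≠ I := by rcases hw with rfl | rfl <;> decide
  have hp {A B : PauliSymbol} (hA : A ≠ I) (hB : B ≠ I) := fun j =>
    hs.pair (by decide) (by decide) hwI (by decide) hN hc j hA hB
  have hz (j : ZMod N) {A B : PauliSymbol} (hA : A ≠ I) (hB : B ≠ I) :
      c (place j (pairString A B)) = 0 :=
    hc.place_eq_zero_of_ne j (a := 0) (b := 1) (by omega) (by omega) (by omega) hA hB
  have hX (j : ZMod N) : c (place j (pairString X I)) = 0 := by
    rcases hw with rfl | rfl
    · have h := hp (A := Z) (B := Z) (by decide) (by decide) j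
      rw [show Z * X = Y from rfl, show Z * Y = X from rfl, show Z * Z = I from rfl,
        hz j (by decide) (by decide), mul_zero, zero_add] at h
      simpa [hJ₂, show weight X I Y Z = 1 from rfl] using h
    · have h := hp (A := Y) (B := Z) (by decide) (by decide) j
      rw [show Y * X = Z from rfl, show Z * Y = X from rfl, show Y * Z = X from rfl,
        show Z * Z = I from rfl, hz j (by decide) (by decide), mul_zero, zero_add] at h
      simpa [hJ₂, show weight X I Z Z = -1 from rfl] using h
  have hX' (j : ZMod N) : c (place j (pairString I X)) = 0 := by
    rw [← hX (j + 1)]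
    refine congrArg c (place_shift j rfl (fun i _ => ?_) ?_)
    · simp only [pairString]; split_ifs <;> first | rfl | contradiction | omega
    · simp only [pairString]; split_ifs <;> first | rfl | contradiction | omega
  cases D with
  | I => exact absurd rfl hD
  | X => exact hX j
  | Y =>
    have h := hp (A := Z) (B := Y) (by decide) (by decide) j
    rcases hw with rfl | rfl
    · rw [show Z * X = Y from rfl, show Z * Y = X from rfl, show Y * Y = I from rfl,
        show Y * Z = X from rfl, hz j (A := X) (B := X) (by decide) (by decide), mul_zero,
        add_zero] at h
      simpa [hJ₁, show weight Y I X Y = -1 from rfl] using h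
    · rw [show Z * X = Y from rfl, show Z * Z = I from rfl, show Y * Y = I from rfl,
        show Y * Z = X from rfl, hX', mul_zero, add_zero] at h
      simpa [hJ₁, show weight Y I X Y = -1 from rfl] using h
  | Z =>
    have h := hp (A := Y) (B := Y) (by decide) (by decide) j
    rcases hw with rfl | rfl
    · rw [show Y * X = Z from rfl, show Y * Y = I from rfl, show Y * Z = X from rfl, hX', mul_zero,
        add_zero] at h
      simpa [hJ₁, show weight Z I X Y = 1 from rfl] using h
    · rw [show Y * X = Z from rfl, show Y * Y = I from rfl, show Y * Z = X from rfl,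
        hz j (A := X) (B := X) (by decide) (by decide), mul_zero, add_zero] at h
      simpa [hJ₁, show weight Z I X Y = 1 from rfl] using h

theorem IsStationary.eq_zero_of_arc_one (hs : IsStationary c J₁ X Y J₂ w Z)
    (hw : w = Y ∨ w = Z) (hJ₁ : J₁ ≠ 0) (hJ₂ : J₂ ≠ 0) (hN : 3 ≤ N) (hc : IsArcSupported 1 c)
    (hI : c (fun _ => I) = 0) : c = 0 := by
  funext P
  by_contra hP
  obtain ⟨a, ha⟩ := hc P hP
  have hPa : P = place a (pairString (P a) I) := by
    funext s
    obtain ⟨i, hi, rfl⟩ := exists_eq_add a s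
    rw [place_add _ _ hi]
    by_cases h0 : i = 0
    · subst h0; simp [pairString]
    · have h1 : P (a + (i : ZMod N)) = I := by
        by_contra h1
        have := ha _ h1
        rw [add_sub_cancel_left, ZMod.val_natCast_of_lt hi] at this
        omega
      simp [pairString, h0, h1]
  refine hP ?_
  by_cases h0 : P a = I
  · rw [h0] at hPa
    have : P = fun _ => I := by
      rw [hPa]; funext s; simp [place, pairString]
    rw [this, hI]; rfl
  · rw [hPa, hs.single_eq_zero hw hJ₁ hJ₂ hN hc a h0]; rfl

theorem place_mainString_two (hN : 3 ≤ N) :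
    place 0 (mainString 2) = (bondConfig X Y 0 : Config N) := by
  funext s
  obtain ⟨i, hi, rfl⟩ := exists_eq_add 0 s
  have h0 := add_natCast_inj (0 : ZMod N) hi (by omega : 0 < N)
  have h1 := add_natCast_inj (0 : ZMod N) hi (by omega : 1 < N)
  simp only [Nat.cast_zero, Nat.cast_one, add_zero] at h0 h1
  rw [place_add _ _ hi]
  simp only [bondConfig, mainString, h0, h1]
  split_ifs <;> first | rfl | omega

/-- Local conserved coefficients vanish if those of the identity and of one bond operator do. -/
theorem IsStationary.eq_zero (hs : IsStationary c J₁ X Y J₂ w Z)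
    (hw : w = Y ∨ w = Z) (hJ₁ : J₁ ≠ 0) (hJ₂ : J₂ ≠ 0) (hN : 3 ≤ N) (hk : 2 * k ≤ N)
    (hc : IsArcSupported k c) (hI : c (fun _ => I) = 0) (hb : c (bondConfig X Y 0) = 0) :
    c = 0 := by
  induction k with
  | zero => exact hs.eq_zero_of_arc_one hw hJ₁ hJ₂ hN (hc.mono (Nat.zero_le 1)) hI
  | succ k ih =>
    rcases Nat.eq_zero_or_pos k with rfl | hk1
    · exact hs.eq_zero_of_arc_one hw hJ₁ hJ₂ hN hc hI
    · have h : IsLocalStationary w J₁ J₂ (k + 1) c :=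
        ⟨hs, hw, hJ₁, hJ₂, by omega, hk, hc⟩
      refine ih (by omega) (hc.pred (by omega) fun j f hf => ?_)
      refine h.eq_zero_of_mainString (fun j => ?_) j hf
      -- At length 2 the string X Z⋯Z Y is the bond `X Y` itself, whose coefficient is zero by `hb`.
      rcases Nat.eq_or_lt_of_le hk1 with rfl | hk2
      · rw [h.mainString_const, place_mainString_two hN, hb]
      · exact h.mainString_eq_zero (by omega) j

end Vanishing

/-! ### From local operators to coefficients, and subtraction of the Hamiltonian. -/

section Locality

variable {N : ℕ}

/-- The coefficients supported in arcs of `k` sites. -/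
def arcSubmodule (N k : ℕ) : Submodule ℝ (Config N → ℝ) where
  carrier := {c | IsArcSupported k c}
  zero_mem' := fun _ h => absurd rfl h
  add_mem' := by
    intro c d hc hd P hP
    by_cases h : c P = 0
    · exact hd P fun h' => hP (by simp [h, h'])
    · exact hc P h
  smul_mem' := by
    intro a c hc P hP
    exact hc P fun h => hP (by simp [h])

theorem mem_arcSubmodule {k : ℕ} {c : Config N → ℝ} :
    c ∈ arcSubmodule N k ↔ IsArcSupported k c := Iff.rfl

/-- Since `s + 2 ≠ s` on three or more sites, the support of a bond shows at which site it begins.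
-/
theorem bondConfig_inj (hN : 3 ≤ N) {u e u' e' : PauliSymbol} (hu : u ≠ I) (he : e ≠ I)
    {s s' : ZMod N} (h : bondConfig u e s = bondConfig u' e' s') : s = s' ∧ u = u' ∧ e = e' := by
  have h01 (r : ZMod N) := self_ne_add_one (by omega : 2 ≤ N) r
  have h02 (r : ZMod N) : r + 1 + 1 ≠ r := by
    have := mt (add_natCast_inj r (by omega : 2 < N) (by omega : 0 < N)).1 (by omega)
    intro h'
    apply this
    rw [Nat.cast_zero, add_zero]
    nth_rewrite 2 [← h']
    push_cast
    ring
  have h1 := congrFun h s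
  have h2 := congrFun h (s + 1)
  simp only [bondConfig, if_true, (h01 s).symm, if_false] at h1 h2
  by_cases hs : s = s'
  · subst hs
    simp only [if_true, (h01 s).symm, if_false] at h1 h2
    exact ⟨rfl, h1, h2⟩
  · rw [if_neg hs] at h1
    by_cases hs' : s = s' + 1
    · subst hs'
      rw [if_neg (h02 s'), if_neg (h01 (s' + 1)).symm] at h2
      exact absurd h2 he
    · rw [if_neg hs'] at h1
      exact absurd h1 hu

theorem bondConfig_uncycle (u e : PauliSymbol) (s : ZMod N) :
    (fun t => (bondConfig u e s t).uncycle) = bondConfig u.uncycle e.uncycle s := by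
  funext t
  simp only [bondConfig]
  split_ifs <;> rfl

theorem IsArcSupported.uncycle {c : Config N → ℝ} {k : ℕ} (hc : IsArcSupported k c) :
    IsArcSupported k fun R => c fun t => (R t).uncycle := by
  intro P hP
  obtain ⟨a, ha⟩ := hc _ hP
  refine ⟨a, fun s hs => ha s ?_⟩
  revert hs
  generalize P s = A
  revert A
  decide

variable [NeZero N]

theorem single_mem_arcSubmodule {k : ℕ} {P : Config N} (a : ZMod N)
    (h : ∀ s, P s ≠ I → (s - a).val < k) : Pi.single P 1 ∈ arcSubmodule N k := by
  intro Q hQ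
  obtain rfl : Q = P := by
    by_contra hne
    exact hQ (Pi.single_eq_of_ne hne 1)
  exact ⟨a, h⟩

/-- For `ℓ ≤ N` the factors act on different sites, so no phase arises. -/
theorem stringOp_eq_pauliOp {ℓ : ℕ} (hℓ : ℓ ≤ N) (A : Fin ℓ → PauliSymbol) (j : ZMod N) :
    stringOp A j = pauliOp (place j fun i => if h : i < ℓ then A ⟨i, h⟩ else I) := by
  induction ℓ with
  | zero =>
    rw [stringOp, List.ofFn_zero, List.prod_nil, ← pauliOp_I]
    rfl
  | succ ℓ ih =>
    have h1 := ih (by omega) fun i => A i.castSucc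
    rw [stringOp] at h1
    rw [stringOp, List.ofFn_succ', List.concat_eq_append, List.prod_append, List.prod_singleton]
    simp only [Fin.val_castSucc, Fin.val_last]
    rw [h1, pauliOp_mul_siteOp _ _ _ (by rw [place_add _ _ (by omega)]; simp)]
    congr 1
    funext s
    obtain ⟨i, hi, rfl⟩ := exists_eq_add j s
    rw [place_add _ _ hi]
    by_cases h2 : i = ℓ
    · subst h2
      simp [Fin.last]
    · rw [Function.update_of_ne (mt (add_natCast_inj j hi (by omega)).1 h2), place_add _ _ hi]
      by_cases h3 : i < ℓ
      · simp [h3, Nat.lt_succ_of_lt h3]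
      · simp [h3, show ¬ i < ℓ + 1 by omega]

theorem IsLocal.exists_coeff {k : ℕ} (hk : k ≤ N) {Q : Operator N} (hQ : IsLocal k Q) :
    ∃ c : Config N → ℝ, IsArcSupported k c ∧ Q = toOp c := by
  obtain ⟨q, q₀, rfl⟩ := hQ
  suffices h : _ ∈ (arcSubmodule N k).map toOp by
    obtain ⟨c, hc, h⟩ := h
    exact ⟨c, hc, h.symm⟩
  refine add_mem (sum_mem fun ℓ hℓ => sum_mem fun A _ => sum_mem fun j _ => ?_) ?_
  · have hℓ' := (Finset.mem_Icc.1 hℓ).2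
    rw [Complex.coe_smul, stringOp_eq_pauliOp (hℓ'.trans hk), ← toOp_single]
    refine Submodule.smul_mem _ _ (Submodule.mem_map_of_mem (single_mem_arcSubmodule j ?_))
    intro s hs
    by_contra h
    exact hs (by simp [place, show ¬ (s - j).val < ℓ by omega])
  · rw [Complex.coe_smul, ← pauliOp_I, ← toOp_single]
    exact Submodule.smul_mem _ _
      (Submodule.mem_map_of_mem (single_mem_arcSubmodule 0 fun _ h => absurd rfl h))

theorem bondConfig_mem_arcSubmodule {k : ℕ} (hk : 2 ≤ k) (hN : 3 ≤ N) (u e : PauliSymbol)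
    (s : ZMod N) : Pi.single (bondConfig u e s) 1 ∈ arcSubmodule N k := by
  refine single_mem_arcSubmodule s fun t ht => ?_
  have : Fact (1 < N) := ⟨by omega⟩
  by_cases h1 : t = s
  · simp [h1]; omega
  by_cases h2 : t = s + 1
  · rw [h2, add_sub_cancel_left, ZMod.val_one]; omega
  · exact absurd (by simp [bondConfig, h1, h2]) ht

theorem bondCoeff_mem_arcSubmodule {k : ℕ} (hk : 2 ≤ k) (hN : 3 ≤ N) (J₁ : ℝ)
    (u₁ e₁ : PauliSymbol) (J₂ : ℝ) (u₂ e₂ : PauliSymbol) :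
    bondCoeff J₁ u₁ e₁ J₂ u₂ e₂ ∈ arcSubmodule N k :=
  sum_mem fun s _ => add_mem (Submodule.smul_mem _ _ (bondConfig_mem_arcSubmodule hk hN u₁ e₁ s))
    (Submodule.smul_mem _ _ (bondConfig_mem_arcSubmodule hk hN u₂ e₂ s))

theorem bondCoeff_apply (hN : 3 ≤ N) (J₁ : ℝ) {u₁ e₁ : PauliSymbol} (J₂ : ℝ)
    {u₂ e₂ : PauliSymbol} (hu : u₁ ≠ I) (he : e₁ ≠ I) (hne : u₁ ≠ u₂) :
    bondCoeff J₁ u₁ e₁ J₂ u₂ e₂ (bondConfig u₁ e₁ (0 : ZMod N)) = J₁ := by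
  rw [bondCoeff, Finset.sum_apply, Finset.sum_eq_single 0]
  · have : bondConfig u₁ e₁ (0 : ZMod N) ≠ bondConfig u₂ e₂ 0 := fun h =>
      hne (bondConfig_inj hN hu he h).2.1
    simp [this]
  · intro s _ hs
    have h1 : bondConfig u₁ e₁ (0 : ZMod N) ≠ bondConfig u₁ e₁ s := fun h =>
      hs (bondConfig_inj hN hu he h).1.symm
    have h2 : bondConfig u₁ e₁ (0 : ZMod N) ≠ bondConfig u₂ e₂ s := fun h =>
      hs (bondConfig_inj hN hu he h).1.symm
    simp [h1, h2]
  · simp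

/-- Conserved quantities are determined by two coefficients as soon as conserved coefficients
vanish when these two do. -/
theorem exists_eq_of_vanishing (hN : 3 ≤ N) {k : ℕ} (hk : 2 * k ≤ N) {J₁ : ℝ}
    {u₁ e₁ : PauliSymbol} {J₂ : ℝ} {u₂ e₂ : PauliSymbol} (hu : u₁ ≠ I) (he : e₁ ≠ I)
    (hne : u₁ ≠ u₂) (hJ₁ : J₁ ≠ 0)
    (H : ∀ c : Config N → ℝ, IsStationary c J₁ u₁ e₁ J₂ u₂ e₂ → IsArcSupported k c →
      c (fun _ => I) = 0 → c (bondConfig u₁ e₁ 0) = 0 → c = 0)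
    {Q : Operator N} (hQ : IsLocalConserved k (bondHamiltonian N J₁ u₁ e₁ J₂ u₂ e₂) Q) :
    ∃ a b : ℝ, Q = (a : ℂ) • bondHamiltonian N J₁ u₁ e₁ J₂ u₂ e₂
      + (b : ℂ) • (1 : Operator N) := by
  obtain ⟨c, hc, rfl⟩ := hQ.1.exists_coeff (by omega)
  have h01 := self_ne_add_one (by omega : 2 ≤ N) (0 : ZMod N)
  -- The Hamiltonian has coefficient `J₁` at this bond, so this `a` cancels the coefficient of `c`
  -- there.
  set a : ℝ := c (bondConfig u₁ e₁ 0) / J₁ with ha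
  set h : Config N → ℝ := bondCoeff J₁ u₁ e₁ J₂ u₂ e₂ with hh
  have hbI : bondConfig u₁ e₁ (0 : ZMod N) ≠ fun _ => I := fun h => by
    have := congrFun h 0
    simp [bondConfig, hu] at this
  set b : ℝ := (c - a • h) (fun _ => I) with hb
  set d : Config N → ℝ := c - a • h - b • Pi.single (fun _ => I) 1 with hd
  have htoOp : toOp d = toOp c - a • bondHamiltonian N J₁ u₁ e₁ J₂ u₂ e₂ - b • (1 : Operator N) := by
    rw [hd, map_sub, map_sub, map_smul, map_smul, toOp_single, pauliOp_I, hh,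
      toOp_bondCoeff (by omega)]
  have hstat : IsStationary d J₁ u₁ e₁ J₂ u₂ e₂ := by
    rw [isStationary_iff (by omega), htoOp]
    have h1 := hQ.2
    rw [Ring.lie_def, sub_eq_zero] at h1 ⊢
    rw [sub_mul, sub_mul, mul_sub, mul_sub, h1]
    simp
  have harc : IsArcSupported k d := by
    refine sub_mem (S := Submodule ℝ _) (sub_mem (mem_arcSubmodule.2 hc) ?_)
      (Submodule.smul_mem _ _ (single_mem_arcSubmodule 0 fun _ h => absurd rfl h))
    by_cases hk2 : 2 ≤ k
    · exact Submodule.smul_mem _ _ (bondCoeff_mem_arcSubmodule hk2 hN _ _ _ _ _ _)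
    -- For `k ≤ 1` the Hamiltonian is not supported in arcs of `k` sites, but then `a = 0`.
    · have h1 : c (bondConfig u₁ e₁ 0) = 0 :=
        (hc.mono (by omega : k ≤ 1)).eq_zero_of_ne h01 (by simpa [bondConfig] using hu)
          (by rwa [bondConfig, if_neg h01.symm, if_pos rfl])
      rw [ha, h1, zero_div, zero_smul]
      exact zero_mem _
  have h0 : d = 0 := by
    refine H d hstat harc ?_ ?_
    · simp [hd, hb]
    · rw [hd, Pi.sub_apply, Pi.sub_apply, Pi.smul_apply, Pi.smul_apply,
        Pi.single_eq_of_ne hbI, hh, bondCoeff_apply hN _ _ hu he hne]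
      simp [ha, hJ₁]
  refine ⟨a, b, ?_⟩
  rw [h0, map_zero, sub_sub, eq_comm, sub_eq_zero] at htoOp
  rw [htoOp, Complex.coe_smul, Complex.coe_smul]

/-- Conserved coefficients are permuted together with the Hamiltonian. -/
theorem IsStationary.uncycle {c : Config N → ℝ} {J₁ : ℝ} {u₁ e₁ : PauliSymbol} {J₂ : ℝ}
    {u₂ e₂ : PauliSymbol}
    (hs : IsStationary c J₁ u₁.uncycle e₁.uncycle J₂ u₂.uncycle e₂.uncycle) :
    IsStationary (fun R => c fun t => (R t).uncycle) J₁ u₁ e₁ J₂ u₂ e₂ := by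
  intro R
  rw [← hs fun t => (R t).uncycle]
  have h (J : ℝ) (u e : PauliSymbol) (s : ZMod N) :
      bondTerm (fun R => c fun t => (R t).uncycle) J u e R s =
        bondTerm c J u.uncycle e.uncycle (fun t => (R t).uncycle) s := by
    rw [bondTerm, bondTerm, ← uncycle_mul, ← uncycle_mul, weight_uncycle, ← bondConfig_uncycle]
    congr 2
    funext t
    exact uncycle_mul _ _
  simp only [h]

theorem IsStationary.eq_zero_uncycle {c : Config N → ℝ} {J₁ J₂ : ℝ} {k : ℕ}
    (hs : IsStationary c J₁ Y Z J₂ X X) (hJ₁ : J₁ ≠ 0) (hJ₂ : J₂ ≠ 0) (hN : 3 ≤ N)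
    (hk : 2 * k ≤ N) (hc : IsArcSupported k c) (hI : c (fun _ => I) = 0)
    (hb : c (bondConfig Y Z 0) = 0) : c = 0 := by
  have h1 := IsStationary.uncycle (u₁ := X) (e₁ := Y) (u₂ := Z) (e₂ := Z) hs
  have h2 := h1.eq_zero (Or.inr rfl) hJ₁ hJ₂ hN hk hc.uncycle hI
    (by rw [bondConfig_uncycle]; exact hb)
  funext P
  have h3 := congrFun h2 fun t => (P t).cycle
  simp only [uncycle_cycle] at h3
  exact h3

end Locality

end SpinChain

/-! ### The two Hamiltonians. -/

theorem theorem3 (N : ℕ) [NeZero N] (hN : 3 ≤ N) (k : ℕ) (hk : (k : ℝ) ≤ (N : ℝ) / 2) :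
    (∀ Jxy Jyz : ℝ, Jxy ≠ 0 → Jyz ≠ 0 → ∀ Q : SpinChain.Operator N,
      SpinChain.IsLocalConserved k (SpinChain.hamiltonian2 N Jxy Jyz) Q →
        ∃ a b : ℝ, Q = (a : ℂ) • SpinChain.hamiltonian2 N Jxy Jyz
          + (b : ℂ) • (1 : SpinChain.Operator N)) ∧
    (∀ Jxx Jyz : ℝ, Jxx ≠ 0 → Jyz ≠ 0 → ∀ Q : SpinChain.Operator N,
      SpinChain.IsLocalConserved k (SpinChain.hamiltonian3 N Jxx Jyz) Q →
        ∃ a b : ℝ, Q = (a : ℂ) • SpinChain.hamiltonian3 N Jxx Jyz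
          + (b : ℂ) • (1 : SpinChain.Operator N)) := by
  have hk' : 2 * k ≤ N := by
    have : (2 : ℝ) * k ≤ N := by linarith
    exact_mod_cast this
  refine ⟨fun Jxy Jyz h1 h2 Q hQ => ?_, fun Jxx Jyz h1 h2 Q hQ => ?_⟩
  · exact SpinChain.exists_eq_of_vanishing (J₁ := Jxy) (u₁ := .X) (e₁ := .Y) (J₂ := Jyz)
      (u₂ := .Y) (e₂ := .Z) hN hk' (by decide) (by decide) (by decide) h1
      (fun c hs hc => hs.eq_zero (Or.inl rfl) h1 h2 hN hk' hc) hQ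
  · have hH : SpinChain.hamiltonian3 N Jxx Jyz =
        SpinChain.bondHamiltonian N Jyz .Y .Z Jxx .X .X :=
      Finset.sum_congr rfl fun _ _ => add_comm _ _
    rw [hH] at hQ ⊢
    exact SpinChain.exists_eq_of_vanishing hN hk' (by decide) (by decide) (by decide) h2
      (fun c hs hc => hs.eq_zero_uncycle h2 h1 hN hk' hc) hQ
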